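/- Let $A$ be a commutative ring with finitely many maximal ideals and, for a maximal ideal $\mathfrak{m} \subset A$, set $k_{\mathfrak{m}} := A/\mathfrak{m}$. Let $C$ be an affine scheme that is smooth of pure relative dimension $1$ over $A$, let $Y \subset C$ be a closed subscheme that is quasi-finite over $A$, and, for each maximal ideal $\mathfrak{m} \subset A$, let $\iota_{\mathfrak{m}} \colon Y_{k_{\mathfrak{m}}} \hookrightarrow \mathbb{A}^1_{k_{\mathfrak{m}}}$ be a closed immersion over $k_{\mathfrak{m}}$, where $Y_{k_{\mathfrak{m}}} := Y \times_{\operatorname{Spec} A} \operatorname{Spec} k_{\mathfrak{m}}$. Then there are an affine open $C' \subset C$ containing $Y_{k_{\mathfrak{m}}}$ for every maximal ideal $\mathfrak{m} \subset A$, an affine open $V \subset \mathbb{A}^1_A$, an étale $A$-morphism $f \colon C' \to V$, and a closed subscheme $Y' \subset V$ such that $f$ restricts to an isomorphism $Y \cap C' \xrightarrow{\sim} Y'$ and the square $$\begin{array}{ccc} Y \cap C' & \hookrightarrow & C' \\ {\scriptstyle\sim}\downarrow & & \downarrow {\scriptstyle f} \\ Y' & \hookrightarrow & V \end{array}$$ is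 Cartesian. -/

import Mathlib

open CategoryTheory CategoryTheory.Limits AlgebraicGeometry

universe u

noncomputable section

namespace Reembed

/-- The affine line `𝔸¹` over `Spec R`. -/
abbrev affineLine (R : Type u) [CommRing R] : Scheme.{u} :=
  𝔸(PUnit.{u + 1}; Spec (CommRingCat.of R))

/-- The structure morphism of the affine line over `Spec R`. -/
abbrev affineLineToSpec (R : Type u) [CommRing R] :
    affineLine R ⟶ Spec (CommRingCat.of R) :=
  𝔸(PUnit.{u + 1}; Spec (CommRingCat.of R)) ↘ Spec (CommRingCat.of R)

variable {A : Type u} [CommRing A]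

/-- The closed point `Spec k_𝔪 ⟶ Spec A`, where `k_𝔪 = A ⧸ 𝔪`. -/
abbrev closedPoint (m : MaximalSpectrum A) :
    Spec (CommRingCat.of (A ⧸ m.asIdeal)) ⟶ Spec (CommRingCat.of A) :=
  Spec.map (CommRingCat.ofHom (Ideal.Quotient.mk m.asIdeal))

/-- The closed fibre `X_{k_𝔪} = X ×_{Spec A} Spec k_𝔪` of an `A`-scheme `p : X ⟶ Spec A`. -/
abbrev closedFibre {X : Scheme.{u}} (p : X ⟶ Spec (CommRingCat.of A))
    (m : MaximalSpectrum A) : Scheme.{u} :=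
  pullback p (closedPoint m)

/-- The canonical morphism `X_{k_𝔪} ⟶ X`. -/
abbrev closedFibreι {X : Scheme.{u}} (p : X ⟶ Spec (CommRingCat.of A))
    (m : MaximalSpectrum A) : closedFibre p m ⟶ X :=
  pullback.fst p (closedPoint m)

/-- The structure morphism `X_{k_𝔪} ⟶ Spec k_𝔪`. -/
abbrev closedFibreToSpec {X : Scheme.{u}} (p : X ⟶ Spec (CommRingCat.of A))
    (m : MaximalSpectrum A) :
    closedFibre p m ⟶ Spec (CommRingCat.of (A ⧸ m.asIdeal)) :=
  pullback.snd p (closedPoint m)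

end Reembed

end

/-! # Étale coordinates on relative curves along quasi-finite closed subschemes -/

noncomputable section

namespace Reembed

open Polynomial TensorProduct

/-! Write `C = Spec B`, `Y = Spec S` with `S = B ⧸ I`, and let `J` be the Jacobson radical of `A`,
so that `A ⧸ J` is a finite product of fields. A neighbourhood of the closed fibres of `Y` may be
shrunk by inverting any element of `B` congruent to 1 modulo `I + J B`; the whole argument consists
of such shrinkings.

The embeddings of the closed fibres give generators of each `S ⧸ 𝔪 S`, which the Chinese remainder
theorem glues to a `τ` generating `S` modulo `J S`. Nakayama's lemma does not apply yet, since `S`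
is only quasi-finite. Zariski's main theorem supplies `b ≡ 1` modulo `J S` such that every element
of `S` becomes integral over `A` after multiplication by a power of `b`. Adding `1 / b - 1` to `b ^
n * τ` keeps the residue of `τ` and makes `S[1/b]` integral over `A[t]`. Now Nakayama's lemma over
`A[X]` shows that `t` embeds `Y`, after shrinking, into the affine line as a locally closed
subscheme.

A lift of `t` to `B` need not be étale over the line. It may be changed by elements of `I`, and as
`B ⧸ (I + J B)` is Artinian, stable range one finds a change whose differential generates `Ω[B⁄A]`
modulo `I + J B`, hence on a neighbourhood. Such a function is étale because `Ω[B⁄A]` has rank one.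

Finally, an étale map that immerses `Y` makes `Y` open in the preimage of its image, by
unramifiedness. Removing the rest of the preimage makes the square Cartesian. -/

/-! ### Gluing generators over the closed points -/

theorem exists_sub_one_mem_maximal_of_finite (A : Type*) [CommRing A] [Finite (MaximalSpectrum A)] :
    ∃ e : MaximalSpectrum A → A, ∀ m, e m - 1 ∈ m.asIdeal ∧ ∀ m', m' ≠ m → e m ∈ m'.asIdeal := by
  classical
  have hco : Pairwise (Function.onFun IsCoprime (fun m : MaximalSpectrum A ↦ m.asIdeal)) :=
    fun m m' hne ↦ Ideal.isCoprime_of_isMaximal (MaximalSpectrum.ext_iff.ne.mp hne)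
  have key (m : MaximalSpectrum A) : ∃ x : A, ∀ m' : MaximalSpectrum A,
      x - (if m' = m then 1 else 0) ∈ m'.asIdeal := by
    obtain ⟨x, hx⟩ := Ideal.pi_quotient_surjective hco
      (fun m' ↦ Ideal.Quotient.mk m'.asIdeal (if m' = m then 1 else 0))
    refine ⟨x, fun m' ↦ ?_⟩
    rw [← Ideal.Quotient.eq, ← hx m']
  choose e he using key
  exact ⟨e, fun m ↦ ⟨by simpa using he m m, fun m' hne ↦ by simpa [hne] using he m m'⟩⟩

theorem mem_jacobson_bot_of_forall_mem {A : Type*} [CommRing A] {x : A}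
    (h : ∀ m : MaximalSpectrum A, x ∈ m.asIdeal) : x ∈ (⊥ : Ideal A).jacobson :=
  Ideal.mem_sInf.mpr fun {m} hm ↦ h ⟨m, hm.2⟩

/-- By the Chinese remainder theorem this quotient is a finite product of fields. -/
instance isArtinianRing_quotient_jacobson (A : Type*) [CommRing A] [Finite (MaximalSpectrum A)] :
    IsArtinianRing (A ⧸ (⊥ : Ideal A).jacobson) := by
  have hco : Pairwise (Function.onFun IsCoprime (fun m : MaximalSpectrum A ↦ m.asIdeal)) :=
    fun m m' hne ↦ Ideal.isCoprime_of_isMaximal (MaximalSpectrum.ext_iff.ne.mp hne)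
  have hJ : (⊥ : Ideal A).jacobson = ⨅ m : MaximalSpectrum A, m.asIdeal := by
    refine le_antisymm (le_iInf fun m ↦ sInf_le ⟨bot_le, m.isMaximal⟩) fun x hx ↦ ?_
    exact mem_jacobson_bot_of_forall_mem fun m ↦ Ideal.mem_iInf.mp hx m
  let := fun m : MaximalSpectrum A ↦ Ideal.Quotient.field m.asIdeal
  exact ((Ideal.quotEquivOfEq hJ).trans
    (Ideal.quotientInfRingEquivPiQuotient _ hco)).symm.surjective.isArtinianRing

theorem sum_smul_sub_mem_map {ι A M : Type*} [Fintype ι] [CommRing A] [CommRing M] [Algebra A M]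
    {𝔞 : ι → Ideal A} {e : ι → A} (he : ∀ i, e i - 1 ∈ 𝔞 i ∧ ∀ j, j ≠ i → e i ∈ 𝔞 j)
    (x : ι → M) (i : ι) : ∑ j, e j • x j - x i ∈ (𝔞 i).map (algebraMap A M) := by
  classical
  rw [← Finset.add_sum_erase _ _ (Finset.mem_univ i)]
  have : e i • x i + ∑ j ∈ Finset.univ.erase i, e j • x j - x i =
      (e i - 1) • x i + ∑ j ∈ Finset.univ.erase i, e j • x j := by
    rw [sub_smul, one_smul]; ring
  rw [this]
  refine add_mem ?_ (sum_mem fun j hj ↦ ?_)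
  · rw [Algebra.smul_def]
    exact Ideal.mul_mem_right _ _ (Ideal.mem_map_of_mem _ (he i).1)
  · rw [Algebra.smul_def]
    exact Ideal.mul_mem_right _ _ (Ideal.mem_map_of_mem _
      ((he j).2 i (Finset.ne_of_mem_erase hj).symm))

/-- Generators of `S / 𝔪 S` for the finitely many maximal ideals `𝔪` of `A` can be glued to a
generator modulo the Jacobson radical. -/
theorem exists_forall_sub_aeval_mem_map_jacobson {A S : Type*} [CommRing A] [CommRing S]
    [Algebra A S] [Finite (MaximalSpectrum A)]
    (h : ∀ m : MaximalSpectrum A, ∃ τ : S, ∀ s, ∃ p : A[X],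
      s - aeval τ p ∈ m.asIdeal.map (algebraMap A S)) :
    ∃ τ : S, ∀ s, ∃ p : A[X], s - aeval τ p ∈ (⊥ : Ideal A).jacobson.map (algebraMap A S) := by
  classical
  have := Fintype.ofFinite (MaximalSpectrum A)
  obtain ⟨e, he⟩ := exists_sub_one_mem_maximal_of_finite A
  choose τ hτ using h
  refine ⟨∑ m, e m • τ m, fun s ↦ ?_⟩
  choose p hp using fun m ↦ hτ m s
  refine ⟨∑ m, e m • p m, ?_⟩
  set y := s - aeval (∑ m, e m • τ m) (∑ m, e m • p m) with hy
  have hym (m : MaximalSpectrum A) : y ∈ m.asIdeal.map (algebraMap A S) := by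
    have h1 : aeval (∑ m, e m • τ m) (∑ m, e m • p m) - aeval (∑ m, e m • τ m) (p m) ∈
        m.asIdeal.map (algebraMap A S) := by
      rw [← map_sub]
      have := Ideal.mem_map_of_mem (aeval (∑ m, e m • τ m) : A[X] →ₐ[A] S) (sum_smul_sub_mem_map he p m)
      change _ ∈ Ideal.map (aeval (∑ m, e m • τ m) : A[X] →ₐ[A] S).toRingHom _ at this
      rwa [Ideal.map_map, AlgHom.toRingHom_eq_coe, AlgHom.comp_algebraMap] at this
    have h2 : aeval (∑ m, e m • τ m) (p m) - aeval (τ m) (p m) ∈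
        m.asIdeal.map (algebraMap A S) := by
      refine Ideal.mem_of_dvd _ ?_ (sum_smul_sub_mem_map he τ m)
      rw [aeval_def, aeval_def, ← Polynomial.eval_map, ← Polynomial.eval_map]
      exact sub_dvd_eval_sub _ _ _
    have : y = (s - aeval (τ m) (p m)) -
        (aeval (∑ m, e m • τ m) (p m) - aeval (τ m) (p m)) -
        (aeval (∑ m, e m • τ m) (∑ m, e m • p m) - aeval (∑ m, e m • τ m) (p m)) := by
      rw [hy]; ring
    rw [this]
    exact sub_mem (sub_mem (hp m) h2) h1
  -- The intersection of the `𝔪 S` may exceed `J S`, so `hym` alone is not enough. The approximate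
  -- idempotents close the gap: `e m * 𝔪 ⊆ J` and `1 - ∑ e m ∈ J`.
  have hdecomp : y = ∑ m, algebraMap A S (e m) * y + algebraMap A S (1 - ∑ m, e m) * y := by
    rw [map_sub, map_sum, map_one, ← Finset.sum_mul]; ring
  rw [hdecomp]
  refine add_mem (sum_mem fun m _ ↦ ?_) (Ideal.mul_mem_right _ _ (Ideal.mem_map_of_mem _ ?_))
  · have h3 : algebraMap A S (e m) * y ∈
        Ideal.map (algebraMap A S) (Ideal.span {e m} * m.asIdeal) := by
      rw [Ideal.map_mul]
      exact Ideal.mul_mem_mul (Ideal.mem_map_of_mem _ (Ideal.mem_span_singleton_self _)) (hym m)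
    refine Ideal.map_mono ?_ h3
    rw [Ideal.span_singleton_mul_le_iff]
    intro z hz
    refine mem_jacobson_bot_of_forall_mem fun m' ↦ ?_
    by_cases hmm : m' = m
    · subst hmm; exact Ideal.mul_mem_left _ _ hz
    · exact Ideal.mul_mem_right _ _ ((he m).2 m' hmm)
  · refine mem_jacobson_bot_of_forall_mem fun m ↦ ?_
    have := sum_smul_sub_mem_map (M := A) he (fun _ ↦ 1) m
    simp only [smul_eq_mul, mul_one, Algebra.algebraMap_self, Ideal.map_id] at this
    simpa using neg_mem this

/-! ### Integrality from Zariski's main theorem -/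

/-- Zariski's main theorem over a base that is Artinian modulo `J`: an affine quasi-finite scheme
is, near the fibre over `J`, a basic open of a scheme integral over the base. -/
theorem exists_sub_one_mem_and_forall_isIntegral_pow_mul {A S : Type*} [CommRing A] [CommRing S]
    [Algebra A S] [Algebra.FiniteType A S] [Algebra.QuasiFinite A S] (J : Ideal A)
    [IsArtinianRing (A ⧸ J)] :
    ∃ b : S, b - 1 ∈ J.map (algebraMap A S) ∧ IsIntegral A b ∧
      ∀ x, ∃ n : ℕ, IsIntegral A (b ^ n * x) := by
  -- A conductor up to powers. The exponent may depend on `x`; for a sum `n + n'` suffices, since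
  -- each binomial term contains `r ^ n` or `r' ^ n'`.
  let c : Ideal (integralClosure A S) :=
    { carrier := {r | ∀ x, ∃ n : ℕ, IsIntegral A ((r : S) ^ n * x)}
      zero_mem' := fun x ↦ ⟨1, by simpa using isIntegral_zero⟩
      add_mem' := by
        intro r r' hr hr' x
        obtain ⟨n, hn⟩ := hr x
        obtain ⟨n', hn'⟩ := hr' x
        refine ⟨n + n', ?_⟩
        rw [Subalgebra.coe_add, add_pow, Finset.sum_mul]
        refine IsIntegral.sum _ fun k hk ↦ ?_
        have hr1 : IsIntegral A (r : S) := r.2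
        have hr2 : IsIntegral A (r' : S) := r'.2
        have hc : IsIntegral A ((Nat.choose (n + n') k : ℕ) : S) := by
          simpa using isIntegral_algebraMap (R := A) (A := S) (x := ((n + n').choose k : A))
        by_cases hkn : n ≤ k
        · have : (r : S) ^ k * (r' : S) ^ (n + n' - k) * ((n + n').choose k : S) * x =
              ((r : S) ^ n * x) * ((r : S) ^ (k - n) * (r' : S) ^ (n + n' - k) *
                ((n + n').choose k : S)) := by
            rw [← Nat.add_sub_cancel' hkn, pow_add]
            simp only [add_tsub_cancel_left]; ring
          rw [this]
          exact hn.mul (((hr1.pow _).mul (hr2.pow _)).mul hc)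
        · have hk' : n' ≤ n + n' - k := by omega
          have : (r : S) ^ k * (r' : S) ^ (n + n' - k) * ((n + n').choose k : S) * x =
              ((r' : S) ^ n' * x) * ((r : S) ^ k * (r' : S) ^ (n + n' - k - n') *
                ((n + n').choose k : S)) := by
            conv_lhs => rw [← Nat.add_sub_cancel' hk', pow_add]
            ring
          rw [this]
          exact hn'.mul (((hr1.pow _).mul (hr2.pow _)).mul hc)
      smul_mem' := by
        intro s r hr x
        obtain ⟨n, hn⟩ := hr x
        refine ⟨n, ?_⟩
        have : ((s • r : integralClosure A S) : S) ^ n * x = (s : S) ^ n * ((r : S) ^ n * x) := by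
          simp [mul_pow, mul_assoc]
        rw [this]
        exact (IsIntegral.pow s.2 n).mul hn }
  have hctop : c.map (algebraMap (integralClosure A S) S) = ⊤ := by
    by_contra hne
    obtain ⟨P, hP, hcP⟩ := Ideal.exists_le_maximal _ hne
    obtain ⟨r, hr, hint, hx⟩ := Algebra.zariskisMainProperty_iff.mp
      (Algebra.ZariskisMainProperty.of_finiteType (R := A) P)
    exact hr (hcP (Ideal.mem_map_of_mem (algebraMap (integralClosure A S) S)
      (x := (⟨r, hint⟩ : integralClosure A S)) hx))
  let JS := J.map (algebraMap A S)
  let f : integralClosure A S →+* S ⧸ JS :=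
    (Ideal.Quotient.mk JS).comp (algebraMap (integralClosure A S) S)
  have hfin : (algebraMap A (S ⧸ JS)).IsIntegral := by
    have : Algebra.QuasiFinite (A ⧸ J) (S ⧸ JS) := .of_restrictScalars A _ _
    have : Module.Finite (A ⧸ J) (S ⧸ JS) := .of_quasiFinite
    have h1 : (algebraMap (A ⧸ J) (S ⧸ JS)).IsIntegral := Algebra.IsIntegral.isIntegral
    rw [IsScalarTower.algebraMap_eq A (A ⧸ J) (S ⧸ JS)]
    exact (RingHom.isIntegral_of_surjective _ Ideal.Quotient.mk_surjective).trans _ _ h1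
  have hfint : f.IsIntegral := by
    refine RingHom.IsIntegral.tower_top (algebraMap A (integralClosure A S)) f ?_
    exact hfin
  -- The map `f` is integral, so by lying over an ideal containing its kernel and extending to the
  -- unit ideal is itself the unit ideal. Thus `1 = b + z` with `b ∈ c` and `z ∈ J S`.
  have : (c ⊔ RingHom.ker f).map f = ⊤ := by
    rw [eq_top_iff, ← Ideal.map_top (Ideal.Quotient.mk JS), ← hctop, Ideal.map_map]
    exact Ideal.map_mono le_sup_left
  rw [Ideal.map_eq_top_iff_of_ker_le f le_sup_right hfint, Ideal.eq_top_iff_one,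
    Submodule.mem_sup] at this
  obtain ⟨b, hb, z, hz, hbz⟩ := this
  refine ⟨b, ?_, b.2, hb⟩
  rw [RingHom.mem_ker] at hz
  rw [← Ideal.Quotient.eq_zero_iff_mem]
  have h1 : f b = 1 := by rw [← map_one f, ← hbz, map_add, hz, add_zero]
  rw [map_sub, map_one, sub_eq_zero]
  exact h1

theorem aeval_eq_of_algHom_eq {A S Q : Type*} [CommRing A] [CommRing S] [CommRing Q] [Algebra A S]
    [Algebra A Q] (q : S →ₐ[A] Q) {x y : S} (h : q x = q y) (p : A[X]) :
    q (aeval x p) = q (aeval y p) := by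
  rw [← aeval_algHom_apply, ← aeval_algHom_apply, h]

/-- If `b ≡ 1` modulo `J` and inverting `b` makes `S` a localization of an integral `A`-algebra,
then `S[1/b]` is integral over `A[t]` for some `t` with prescribed residue modulo `J`:
one can take `t = b ^ n * τ - 1 + 1 / b`. -/
theorem exists_isIntegral_aeval_and_forall_sub_aeval_mem {A S S₁ : Type*} [CommRing A] [CommRing S]
    [CommRing S₁] [Algebra A S] [Algebra A S₁] (J : Ideal A) (g : S →ₐ[A] S₁) (b : S) (β : S₁)
    (hβ : g b * β = 1) (hg : ∀ x, ∃ s, ∃ k : ℕ, x = g s * β ^ k)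
    (hb : b - 1 ∈ J.map (algebraMap A S))
    (hint : ∀ x, ∃ n : ℕ, IsIntegral A (b ^ n * x)) (τ : S)
    (hτ : ∀ s, ∃ p : A[X], s - aeval τ p ∈ J.map (algebraMap A S)) :
    ∃ t : S₁, (aeval t : A[X] →ₐ[A] S₁).toRingHom.IsIntegral ∧
      ∀ x, ∃ p : A[X], x - aeval t p ∈ J.map (algebraMap A S₁) := by
  obtain ⟨n, hn⟩ := hint τ
  -- Since `b ^ n * τ` is integral over `A`, the summand `β` makes `1 / b` integral over `A[t]`; the
  -- `-1` offsets `β ≡ 1`, so `t ≡ τ` modulo `J`.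
  set t : S₁ := g (b ^ n * τ) - 1 + β with ht
  refine ⟨t, fun x ↦ ?_, fun x ↦ ?_⟩
  · let := (aeval t : A[X] →ₐ[A] S₁).toRingHom.toAlgebra
    have : IsScalarTower A A[X] S₁ :=
      .of_algebraMap_eq' (AlgHom.comp_algebraMap (aeval t : A[X] →ₐ[A] S₁)).symm
    have hup {y : S} (hy : IsIntegral A y) : IsIntegral A[X] (g y) := (hy.map g).tower_top
    have hβint : IsIntegral A[X] β := by
      have ht' : IsIntegral A[X] t := by
        have : t = algebraMap A[X] S₁ X := (aeval_X t).symm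
        rw [this]; exact isIntegral_algebraMap
      have : β = t + 1 - g (b ^ n * τ) := by rw [ht]; ring
      rw [this]
      exact (ht'.add isIntegral_one).sub (hup hn)
    obtain ⟨s, k, rfl⟩ := hg x
    obtain ⟨m, hm⟩ := hint s
    have : g s * β ^ k = g (b ^ m * s) * β ^ (m + k) := by
      rw [map_mul, map_pow, pow_add]
      calc g s * β ^ k = (g b * β) ^ m * (g s * β ^ k) := by rw [hβ, one_pow, one_mul]
        _ = _ := by ring
    change IsIntegral A[X] _
    rw [this]
    exact (hup hm).mul (hβint.pow _)
  · let q := Ideal.Quotient.mkₐ A (J.map (algebraMap A S₁))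
    have hq {y : S} (hy : y ∈ J.map (algebraMap A S)) : q (g y) = 0 := by
      rw [Ideal.Quotient.mkₐ_eq_mk, Ideal.Quotient.eq_zero_iff_mem]
      have := Ideal.mem_map_of_mem g.toRingHom hy
      rwa [Ideal.map_map, AlgHom.toRingHom_eq_coe, AlgHom.comp_algebraMap] at this
    have hqb : q (g b) = 1 := by
      have := hq hb
      rwa [map_sub, map_sub, map_one, map_one, sub_eq_zero] at this
    have hqβ : q β = 1 := by
      have := congr_arg q hβ
      rwa [map_mul, hqb, one_mul, map_one] at this
    have hqt : q t = q (g τ) := by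
      rw [ht]; simp [hqb, hqβ]
    obtain ⟨s, k, rfl⟩ := hg x
    obtain ⟨p, hp⟩ := hτ s
    refine ⟨p, ?_⟩
    rw [← Ideal.Quotient.eq_zero_iff_mem, ← Ideal.Quotient.mkₐ_eq_mk A]
    change q _ = 0
    have h1 := hq hp
    rw [map_sub, map_sub, sub_eq_zero] at h1
    rw [map_sub, map_mul, map_pow, hqβ, one_pow, mul_one, h1, aeval_eq_of_algHom_eq q hqt,
      aeval_algHom_apply, sub_self]

/-! ### Localizing a closed subscheme -/

section LocalizationQuotient

variable {A B : Type*} (L : Type*) [CommRing A] [CommRing B] [CommRing L] [Algebra A B]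
  [Algebra B L] [Algebra A L] [IsScalarTower A B L] (I : Ideal B)

/-- The map `B ⧸ I → L ⧸ I L` induced by an algebra `B → L`. -/
def quotientMapExtension : B ⧸ I →ₐ[A] L ⧸ I.map (algebraMap B L) :=
  Ideal.quotientMapₐ _ (IsScalarTower.toAlgHom A B L) Ideal.le_comap_map

@[simp]
theorem quotientMapExtension_mk (x : B) :
    quotientMapExtension (A := A) L I (Ideal.Quotient.mk I x) =
      Ideal.Quotient.mk (I.map (algebraMap B L)) (algebraMap B L x) :=
  rfl

variable (b : B) [IsLocalization.Away b L]

theorem quotientMapExtension_mul_invSelf :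
    quotientMapExtension (A := A) L I (Ideal.Quotient.mk I b) *
      Ideal.Quotient.mk (I.map (algebraMap B L)) (IsLocalization.Away.invSelf b) = 1 := by
  rw [quotientMapExtension_mk, ← map_mul, IsLocalization.Away.mul_invSelf, map_one]

theorem exists_eq_quotientMapExtension_mul_pow (x : L ⧸ I.map (algebraMap B L)) :
    ∃ s, ∃ k : ℕ, x = quotientMapExtension (A := A) L I s *
      Ideal.Quotient.mk (I.map (algebraMap B L)) (IsLocalization.Away.invSelf b) ^ k := by
  obtain ⟨x, rfl⟩ := Ideal.Quotient.mk_surjective x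
  obtain ⟨k, y, hy⟩ := IsLocalization.Away.surj b x
  refine ⟨Ideal.Quotient.mk I y, k, ?_⟩
  rw [quotientMapExtension_mk, ← map_pow, ← map_mul, ← hy, mul_assoc, ← mul_pow,
    IsLocalization.Away.mul_invSelf, one_pow, mul_one]

include b in
theorem quasiFinite_quotient_map_of_away [Algebra.QuasiFinite A (B ⧸ I)] :
    Algebra.QuasiFinite A (L ⧸ I.map (algebraMap B L)) := by
  refine .of_forall_exists_mul_mem_range (quotientMapExtension (A := A) L I) fun x ↦ ?_
  obtain ⟨s, k, rfl⟩ := exists_eq_quotientMapExtension_mul_pow (A := A) L I b x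
  have h := quotientMapExtension_mul_invSelf (A := A) L I b
  refine ⟨Ideal.Quotient.mk I b ^ k, ?_, s, ?_⟩
  · rw [map_pow]
    exact (IsUnit.of_mul_eq_one _ h).pow k
  · rw [map_pow, mul_assoc, ← mul_pow, mul_comm (Ideal.Quotient.mk _ _), h, one_pow, mul_one]
    rfl

end LocalizationQuotient

/-! ### Étale coordinates and shrinking -/

/-- The conclusion of the algebraic part for a closed subscheme `V(I)` of `Spec B` over `Spec A`:
there are a basic open `Spec L` of `Spec B` containing `V(I) ∩ V(J B)` and an étale map
`Spec L → D(r) ⊆ 𝔸¹_A` which restricts to a closed immersion on `V(I L)` and for which `V(I L)` is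
the preimage of its image. -/
def HasEtaleCoordinate (A : Type u) {B : Type u} [CommRing A] [CommRing B] [Algebra A B]
    (J : Ideal A) (I : Ideal B) : Prop :=
  ∃ (L : Type u) (_ : CommRing L) (_ : Algebra B L) (_ : Algebra A L) (_ : IsScalarTower A B L)
    (r : A[X]) (φ : A[X] →ₐ[A] L),
    Algebra.IsStandardOpenImmersion B L ∧
    (∀ P : Ideal B, P.IsPrime → I ≤ P → J.map (algebraMap A B) ≤ P →
      ∃ Q : Ideal L, Q.IsPrime ∧ Q.comap (algebraMap B L) = P) ∧
    IsUnit (φ r) ∧ φ.toRingHom.Etale ∧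
    (∀ x : L, ∃ (p : A[X]) (n : ℕ), φ r ^ n * x - φ p ∈ I.map (algebraMap B L)) ∧
    I.map (algebraMap B L) ≤ ((I.map (algebraMap B L)).comap φ).map φ

theorem exists_prime_comap_eq_of_sub_one_mem {B L : Type*} [CommRing B] [CommRing L] [Algebra B L]
    (b : B) [IsLocalization.Away b L] {K : Ideal B} (hb : b - 1 ∈ K) (P : Ideal B) (hP : P.IsPrime)
    (hK : K ≤ P) : ∃ Q : Ideal L, Q.IsPrime ∧ Q.comap (algebraMap B L) = P := by
  have hbP : b ∉ P := fun h ↦ hP.ne_top <| by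
    rw [Ideal.eq_top_iff_one]
    simpa using sub_mem h (hK hb)
  have hdisj : Disjoint (Submonoid.powers b : Set B) (P : Set B) := by
    rw [Ideal.disjoint_powers_iff_notMem_of_isPrime]
    exact hbP
  exact ⟨P.map (algebraMap B L), IsLocalization.isPrime_of_isPrime_disjoint (.powers b) L P hP hdisj,
    IsLocalization.under_map_of_isPrime_disjoint (.powers b) L hP hdisj⟩

/-- The element `b` vanishes at no point of `V(I) ∩ V(J B)`, so passing to `D(b)` loses nothing that
has to be kept. -/
theorem HasEtaleCoordinate.of_away {A B : Type u} (L : Type u) [CommRing A] [CommRing B]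
    [CommRing L] [Algebra A B] [Algebra B L] [Algebra A L] [IsScalarTower A B L] {J : Ideal A}
    {I : Ideal B} (b : B) [IsLocalization.Away b L] (hb : b - 1 ∈ I ⊔ J.map (algebraMap A B))
    (h : HasEtaleCoordinate A J (I.map (algebraMap B L))) : HasEtaleCoordinate A J I := by
  obtain ⟨L', _, _, _, _, r, φ, hL', hrange, hr, hφ, hsurj, hI⟩ := h
  let : Algebra B L' := ((algebraMap L L').comp (algebraMap B L)).toAlgebra
  have : IsScalarTower B L L' := .of_algebraMap_eq' rfl
  have : IsScalarTower A B L' := .of_algebraMap_eq' (by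
    rw [IsScalarTower.algebraMap_eq A L L', IsScalarTower.algebraMap_eq A B L,
      IsScalarTower.algebraMap_eq B L L', RingHom.comp_assoc])
  have : Algebra.IsStandardOpenImmersion B L := ⟨b, inferInstance⟩
  have hmap : (I.map (algebraMap B L)).map (algebraMap L L') = I.map (algebraMap B L') := by
    rw [Ideal.map_map, ← IsScalarTower.algebraMap_eq]
  rw [hmap] at hI hsurj
  refine ⟨L', _, _, _, inferInstance, r, φ, .trans B L L', fun P hP hIP hJP ↦ ?_, hr, hφ, hsurj, hI⟩
  obtain ⟨Q, hQ, rfl⟩ := exists_prime_comap_eq_of_sub_one_mem (L := L) b hb P hP (sup_le hIP hJP)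
  obtain ⟨Q', hQ', rfl⟩ := hrange Q hQ (Ideal.map_le_iff_le_comap.mpr hIP) (by
    rw [IsScalarTower.algebraMap_eq A B L, ← Ideal.map_map]
    exact Ideal.map_le_iff_le_comap.mpr hJP)
  exact ⟨Q', hQ', by rw [Ideal.comap_comap, ← IsScalarTower.algebraMap_eq]⟩

/-! ### Closed subschemes immersed by an unramified map -/

section Unramified

variable {R B : Type*} [CommRing R] [CommRing B] [Algebra R B] {I : Ideal B} {r : R}

theorem surjective_liftAlgHom_away {Q : Type*} [CommRing Q] [Algebra R Q]
    (hr : IsUnit (algebraMap R Q r))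
    (hsurj : ∀ x : Q, ∃ (p : R) (n : ℕ), algebraMap R Q r ^ n * x = algebraMap R Q p) :
    ∃ ψ : Localization.Away r →ₐ[R] Q, Function.Surjective ψ := by
  have hu : ∀ y : Submonoid.powers r, IsUnit (Algebra.ofId R Q y) := by
    rintro ⟨_, n, rfl⟩
    simpa [Algebra.ofId_apply] using hr.pow n
  refine ⟨IsLocalization.liftAlgHom (M := Submonoid.powers r) (f := Algebra.ofId R Q) hu, fun x ↦ ?_⟩
  obtain ⟨p, n, h⟩ := hsurj x
  refine ⟨IsLocalization.mk' _ p (⟨r ^ n, n, rfl⟩ : Submonoid.powers r), ?_⟩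
  rw [IsLocalization.liftAlgHom_apply, IsLocalization.lift_mk'_spec]
  simpa [Algebra.ofId_apply] using h.symm

/-- A closed subscheme `V(I)` of an unramified `R`-scheme that is a locally closed subscheme of
`Spec R` has trivial conormal module relative to its scheme-theoretic image. -/
theorem le_map_comap_sup_sq [Algebra.FormallyUnramified R B] (hr : IsUnit (algebraMap R B r))
    (hsurj : ∀ x : B, ∃ (p : R) (n : ℕ), algebraMap R B r ^ n * x - algebraMap R B p ∈ I) :
    I ≤ (I.comap (algebraMap R B)).map (algebraMap R B) ⊔ I ^ 2 := by
  set K := (I.comap (algebraMap R B)).map (algebraMap R B) ⊔ I ^ 2 with hK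
  have hKI : K ≤ I := sup_le Ideal.map_comap_le (Ideal.pow_le_self two_ne_zero)
  obtain ⟨ψ₁, hψ₁⟩ := surjective_liftAlgHom_away (R := R) (r := r) (Q := B ⧸ I)
    (hr.map (Ideal.Quotient.mk I)) fun x ↦ by
      obtain ⟨x, rfl⟩ := Ideal.Quotient.mk_surjective x
      obtain ⟨p, n, h⟩ := hsurj x
      refine ⟨p, n, ?_⟩
      change Ideal.Quotient.mk I _ ^ n * _ = Ideal.Quotient.mk I _
      rwa [← map_pow, ← map_mul, Ideal.Quotient.eq]
  have hu : ∀ y : Submonoid.powers r, IsUnit (Algebra.ofId R (B ⧸ K) y) := by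
    rintro ⟨_, n, rfl⟩
    simpa [Algebra.ofId_apply] using (hr.map (Ideal.Quotient.mk K)).pow n
  let ψ₂ : Localization.Away r →ₐ[R] B ⧸ K :=
    IsLocalization.liftAlgHom (M := Submonoid.powers r) (f := Algebra.ofId R (B ⧸ K)) hu
  let f : B ⧸ K →ₐ[R] B ⧸ I := Ideal.Quotient.factorₐ R hKI
  have hf : f.comp ψ₂ = ψ₁ := IsLocalization.algHom_ext (Submonoid.powers r) (Subsingleton.elim _ _)
  -- This lets `ψ₂` descend along the surjection `ψ₁`, giving an `R`-algebra map `B ⧸ I → B ⧸ K`.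
  -- Composed with `B → B ⧸ I` it is a second lift of that quotient map through the square-zero
  -- extension `B ⧸ K → B ⧸ I`. Unramifiedness identifies it with `B → B ⧸ K`, which therefore kills
  -- `I`.
  have hker : RingHom.ker ψ₁.toRingHom ≤ RingHom.ker ψ₂.toRingHom := by
    intro z hz
    obtain ⟨p, s, rfl⟩ := IsLocalization.exists_mk'_eq (Submonoid.powers r) z
    have hunit : IsUnit (algebraMap R (Localization.Away r) s) :=
      IsLocalization.map_units (Localization.Away r) s
    have hz' : ψ₁ (algebraMap R _ p) = 0 := by
      rw [← IsLocalization.mk'_spec (Localization.Away r) p s, map_mul]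
      rw [show ψ₁ (IsLocalization.mk' _ p s) = 0 from hz, zero_mul]
    have hp : algebraMap R B p ∈ I := by
      rw [AlgHom.commutes] at hz'
      exact Ideal.Quotient.eq_zero_iff_mem.mp hz'
    have hp' : ψ₂ (algebraMap R _ p) = 0 := by
      rw [AlgHom.commutes]
      exact Ideal.Quotient.eq_zero_iff_mem.mpr (Ideal.mem_sup_left
        (Ideal.mem_map_of_mem _ hp))
    rw [← IsLocalization.mk'_spec (Localization.Away r) p s, map_mul] at hp'
    exact (hunit.map ψ₂).mul_left_eq_zero.mp hp'
  let σ : B →ₐ[R] B ⧸ K := (AlgHom.liftOfSurjective ψ₁ hψ₁ ψ₂ hker).comp (Ideal.Quotient.mkₐ R I)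
  have hσ : Ideal.Quotient.mkₐ R K = σ := by
    refine Algebra.FormallyUnramified.ext' f.toRingHom ⟨2, ?_⟩ _ _ fun x ↦ ?_
    · rw [Ideal.zero_eq_bot, eq_bot_iff, pow_two, Ideal.mul_le]
      intro x hx y hy
      obtain ⟨x, rfl⟩ := Ideal.Quotient.mk_surjective x
      obtain ⟨y, rfl⟩ := Ideal.Quotient.mk_surjective y
      have hx' : x ∈ I := Ideal.Quotient.eq_zero_iff_mem.mp hx
      have hy' : y ∈ I := Ideal.Quotient.eq_zero_iff_mem.mp hy
      rw [← map_mul]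
      refine Ideal.Quotient.eq_zero_iff_mem.mpr (Ideal.mem_sup_right ?_)
      rw [pow_two]
      exact Ideal.mul_mem_mul hx' hy'
    · obtain ⟨z, hz⟩ := hψ₁ (Ideal.Quotient.mk I x)
      have h1 : σ x = ψ₂ z := by
        change AlgHom.liftOfSurjective ψ₁ hψ₁ ψ₂ hker (Ideal.Quotient.mk I x) = _
        rw [← hz, AlgHom.liftOfSurjective_apply]
      change Ideal.Quotient.mk I x = f (σ x)
      rw [h1, ← hz, ← hf]; rfl
  intro x hx
  rw [← Ideal.Quotient.eq_zero_iff_mem]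
  change Ideal.Quotient.mkₐ R K x = 0
  rw [hσ]
  change AlgHom.liftOfSurjective ψ₁ hψ₁ ψ₂ hker (Ideal.Quotient.mk I x) = 0
  rw [Ideal.Quotient.eq_zero_iff_mem.mpr hx, map_zero]

/-- Supplies the finiteness for Nakayama's lemma without Noetherian hypotheses: the relations `r ^ n
* x - p`, for `x` in a finite set of algebra generators, suffice modulo the ideal extended from `R`.
-/
theorem exists_finset_span_sup_map_comap_eq [Algebra.FiniteType R B]
    (hr : IsUnit (algebraMap R B r))
    (hsurj : ∀ x : B, ∃ (p : R) (n : ℕ), algebraMap R B r ^ n * x - algebraMap R B p ∈ I) :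
    ∃ s : Finset B, Ideal.span (s : Set B) ⊔ (I.comap (algebraMap R B)).map (algebraMap R B) = I := by
  classical
  obtain ⟨s, hs⟩ := Algebra.FiniteType.out (R := R) (A := B)
  choose p n hpn using hsurj
  let s' : Finset B := s.image fun x ↦ algebraMap R B r ^ n x * x - algebraMap R B (p x)
  refine ⟨s', ?_⟩
  set K := Ideal.span (s' : Set B) ⊔ (I.comap (algebraMap R B)).map (algebraMap R B) with hK
  refine le_antisymm (sup_le (Ideal.span_le.mpr ?_) Ideal.map_comap_le) fun x hx ↦ ?_
  · intro x hx
    obtain ⟨y, -, rfl⟩ := Finset.mem_image.mp (Finset.mem_coe.mp hx)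
    exact hpn y
  have key (x : B) : ∃ (p : R) (n : ℕ), algebraMap R B r ^ n * x - algebraMap R B p ∈ K := by
    have hx : x ∈ Algebra.adjoin R (s : Set B) := hs ▸ Algebra.mem_top
    induction hx using Algebra.adjoin_induction with
    | mem x hx =>
      exact ⟨p x, n x, le_sup_left (a := Ideal.span (s' : Set B))
        (Ideal.subset_span (Finset.mem_coe.mpr (Finset.mem_image_of_mem _ hx)))⟩
    | algebraMap y => exact ⟨y, 0, by simp⟩
    | add x y _ _ hx hy =>
      obtain ⟨a, k, ha⟩ := hx
      obtain ⟨b, l, hb⟩ := hy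
      refine ⟨r ^ l * a + r ^ k * b, k + l, ?_⟩
      have : algebraMap R B r ^ (k + l) * (x + y) - algebraMap R B (r ^ l * a + r ^ k * b) =
          algebraMap R B r ^ l * (algebraMap R B r ^ k * x - algebraMap R B a) +
          algebraMap R B r ^ k * (algebraMap R B r ^ l * y - algebraMap R B b) := by
        simp only [map_add, map_mul, map_pow]; ring
      rw [this]
      exact add_mem (Ideal.mul_mem_left _ _ ha) (Ideal.mul_mem_left _ _ hb)
    | mul x y _ _ hx hy =>
      obtain ⟨a, k, ha⟩ := hx
      obtain ⟨b, l, hb⟩ := hy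
      refine ⟨a * b, k + l, ?_⟩
      have : algebraMap R B r ^ (k + l) * (x * y) - algebraMap R B (a * b) =
          (algebraMap R B r ^ l * y) * (algebraMap R B r ^ k * x - algebraMap R B a) +
          algebraMap R B a * (algebraMap R B r ^ l * y - algebraMap R B b) := by
        simp only [map_mul]; ring
      rw [this]
      exact add_mem (Ideal.mul_mem_left _ _ ha) (Ideal.mul_mem_left _ _ hb)
  have hKI : K ≤ I := by
    refine sup_le (Ideal.span_le.mpr ?_) Ideal.map_comap_le
    intro x hx
    obtain ⟨y, -, rfl⟩ := Finset.mem_image.mp (Finset.mem_coe.mp hx)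
    exact hpn y
  obtain ⟨a, k, ha⟩ := key x
  have haI : algebraMap R B a ∈ I := by
    have := sub_mem (Ideal.mul_mem_left I (algebraMap R B r ^ k) hx) (hKI ha)
    simpa using this
  have : algebraMap R B r ^ k * x ∈ K := by
    have := add_mem ha (le_sup_right (a := Ideal.span (s' : Set B))
      (Ideal.mem_map_of_mem (algebraMap R B) (I := I.comap (algebraMap R B)) haI))
    simpa using this
  exact (Ideal.unit_mul_mem_iff_mem K (hr.pow k)).mp this

/-- In the situation of a locally closed subscheme of the base, `V(I)` is open in the preimage of
its scheme-theoretic image. -/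
theorem exists_sub_one_mem_and_forall_mul_mem_map_comap [Algebra.FormallyUnramified R B]
    [Algebra.FiniteType R B] (hr : IsUnit (algebraMap R B r))
    (hsurj : ∀ x : B, ∃ (p : R) (n : ℕ), algebraMap R B r ^ n * x - algebraMap R B p ∈ I) :
    ∃ w : B, w - 1 ∈ I ∧ ∀ x ∈ I, w * x ∈ (I.comap (algebraMap R B)).map (algebraMap R B) := by
  set K := (I.comap (algebraMap R B)).map (algebraMap R B) with hK
  obtain ⟨s, hs⟩ := exists_finset_span_sup_map_comap_eq hr hsurj
  let N : Submodule B (B ⧸ K) := Submodule.map K.mkQ I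
  have hNfg : N.FG := by
    have : N = Submodule.map K.mkQ (Ideal.span (s : Set B)) := by
      change Submodule.map K.mkQ I = _
      rw [← hs]
      change Submodule.map K.mkQ (Ideal.span (s : Set B) ⊔ K) = _
      rw [Submodule.map_sup, Submodule.mkQ_map_self, sup_bot_eq]
    rw [this]
    exact (Submodule.fg_span s.finite_toSet).map _
  -- Here `N = I / K`, and vanishing of the conormal module says `I = K + I ^ 2`.
  have hN : N ≤ I • N := by
    change Submodule.map K.mkQ I ≤ I • Submodule.map K.mkQ I
    rw [← Submodule.map_smul'']
    conv_lhs => rw [← sup_eq_right.mpr (Ideal.map_comap_le : K ≤ I)]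
    refine (Submodule.map_mono (sup_le le_sup_left (le_map_comap_sup_sq hr hsurj))).trans ?_
    rw [Submodule.map_sup, Submodule.mkQ_map_self, bot_sup_eq, pow_two, smul_eq_mul]
  obtain ⟨w, hw, hwN⟩ := Submodule.exists_sub_one_mem_and_smul_eq_zero_of_fg_of_le_smul I N hNfg hN
  refine ⟨w, hw, fun x hx ↦ ?_⟩
  have := hwN _ (Submodule.mem_map_of_mem hx)
  rw [← map_smul] at this
  simpa using (Submodule.Quotient.mk_eq_zero K).mp this

end Unramified

/-- Inverting `w ≡ 1` modulo `I` leaves `V(I)` unchanged and discards the rest of the preimage of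
its scheme-theoretic image. -/
theorem HasEtaleCoordinate.of_etale {A B : Type u} [CommRing A] [CommRing B] [Algebra A B]
    (J : Ideal A) (I : Ideal B) (r : A[X]) (φ : A[X] →ₐ[A] B) (hr : IsUnit (φ r))
    (hφ : φ.toRingHom.Etale) (hsurj : ∀ x : B, ∃ (p : A[X]) (n : ℕ), φ r ^ n * x - φ p ∈ I) :
    HasEtaleCoordinate A J I := by
  obtain ⟨w, hwI, hw⟩ : ∃ w : B, w - 1 ∈ I ∧ ∀ x ∈ I, w * x ∈ (I.comap φ).map φ := by
    let := φ.toRingHom.toAlgebra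
    have : Algebra.Etale A[X] B := hφ
    exact exists_sub_one_mem_and_forall_mul_mem_map_comap (R := A[X]) (B := B) hr hsurj
  let L := Localization.Away w
  let φ' : A[X] →ₐ[A] L := (IsScalarTower.toAlgHom A B L).comp φ
  have hwL : IsUnit (algebraMap B L w) := IsLocalization.Away.algebraMap_isUnit w
  refine ⟨L, inferInstance, inferInstance, inferInstance, inferInstance, r, φ', ⟨w, inferInstance⟩,
    fun P hP hIP _ ↦ exists_prime_comap_eq_of_sub_one_mem w hwI P hP hIP, hr.map (algebraMap B L), ?_, ?_, ?_⟩
  · have h2 : (algebraMap B L).Etale := RingHom.etale_algebraMap.mpr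
      (Algebra.Etale.of_isLocalizationAway w)
    exact RingHom.Etale.stableUnderComposition _ _ hφ h2
  · intro x
    obtain ⟨k, y, hy⟩ := IsLocalization.Away.surj w x
    obtain ⟨p, n, h⟩ := hsurj y
    refine ⟨p, n, ?_⟩
    have hwk : w ^ k - 1 ∈ I := Ideal.mem_of_dvd _ (sub_one_dvd_pow_sub_one w k) hwI
    have h1 : algebraMap B L (φ r ^ n * y - φ p) ∈ I.map (algebraMap B L) :=
      Ideal.mem_map_of_mem _ h
    have h2 : algebraMap B L (w ^ k - 1) ∈ I.map (algebraMap B L) := Ideal.mem_map_of_mem _ hwk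
    have : φ' r ^ n * x - φ' p = algebraMap B L (φ r ^ n * y - φ p) -
        (φ' r ^ n * x) * algebraMap B L (w ^ k - 1) := by
      change algebraMap B L (φ r) ^ n * x - algebraMap B L (φ p) = _ -
        (algebraMap B L (φ r) ^ n * x) * _
      simp only [map_sub, map_mul, map_pow, map_one, ← hy]
      ring
    rw [this]
    exact sub_mem h1 (Ideal.mul_mem_left _ _ h2)
  · rw [Ideal.map_le_iff_le_comap]
    intro x hx
    have h1 : algebraMap B L (w * x) ∈ ((I.comap φ).map φ).map (algebraMap B L) :=
      Ideal.mem_map_of_mem _ (hw x hx)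
    rw [map_mul, Ideal.unit_mul_mem_iff_mem _ hwL] at h1
    refine Ideal.mem_comap.mpr (SetLike.le_def.mp ?_ h1)
    rw [Ideal.map_le_iff_le_comap, Ideal.map_le_iff_le_comap]
    intro p hp
    exact Ideal.mem_map_of_mem φ' (Ideal.mem_map_of_mem (algebraMap B L) hp)

/-! ### Coordinates with generating differential -/

open KaehlerDifferential

/-- Artinian rings have stable range one. -/
theorem exists_mem_isUnit_add_of_isArtinianRing {T : Type*} [CommRing T] [IsArtinianRing T]
    (D : Ideal T) (u : T) (h : D ⊔ Ideal.span {u} = ⊤) : ∃ d ∈ D, IsUnit (u + d) := by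
  obtain ⟨n, x, hx⟩ := IsArtinian.exists_pow_succ_smul_dvd u (1 : T)
  simp only [Nat.succ_eq_add_one, smul_eq_mul, mul_one] at hx
  have hk (k : ℕ) : u ^ n = u ^ (n + k) * x ^ k := by
    induction k with
    | zero => simp
    | succ k ih =>
      calc u ^ n = u ^ n * (u ^ k * x ^ k) := by rw [← mul_assoc, ← pow_add, ← ih]
        _ = (u ^ (n + 1) * x) * (u ^ k * x ^ k) := by rw [hx]
        _ = _ := by ring
  -- Fitting decomposition: `e` is idempotent, `u` is invertible on the factor of `e` and nilpotent
  -- on that of `1 - e`. As `u` is a unit modulo `D`, the factor of `1 - e` lies in `D`, so `u` can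
  -- be replaced there by 1.
  set e := u ^ (n + 1) * x ^ (n + 1) with he
  have hen : (1 - e) * u ^ n = 0 := by
    have := hk (n + 1)
    rw [sub_mul, one_mul, he, sub_eq_zero]
    calc u ^ n = u ^ (n + (n + 1)) * x ^ (n + 1) := this
      _ = _ := by ring
  have hee : (1 - e) * e = 0 := by
    calc (1 - e) * e = ((1 - e) * u ^ n) * (u * x ^ (n + 1)) := by rw [he]; ring
      _ = 0 := by rw [hen, zero_mul]
  obtain ⟨d, hd, z, hz, hdz⟩ := Submodule.mem_sup.mp ((Ideal.eq_top_iff_one _).mp h)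
  obtain ⟨y, rfl⟩ := Ideal.mem_span_singleton.mp hz
  have h1 : u * y - 1 ∈ D := by
    have : u * y - 1 = -d := by rw [← hdz]; ring
    rw [this]; exact neg_mem hd
  have h2 : (u * y) ^ n - 1 ∈ D := Ideal.mem_of_dvd _ (sub_one_dvd_pow_sub_one _ n) h1
  have h3 : 1 - e ∈ D := by
    have : 1 - e = -(1 - e) * ((u * y) ^ n - 1) + ((1 - e) * u ^ n) * y ^ n := by ring
    rw [this, hen, zero_mul, add_zero]
    exact Ideal.mul_mem_left _ _ h2
  refine ⟨(1 - e) * (1 - u), Ideal.mul_mem_right _ _ h3,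
    IsUnit.of_mul_eq_one (u ^ n * x ^ (n + 1) * e + (1 - e)) ?_⟩
  calc (u + (1 - e) * (1 - u)) * (u ^ n * x ^ (n + 1) * e + (1 - e))
      = u ^ (n + 1) * x ^ (n + 1) * e * e + (1 - e) * (1 - e) +
          ((1 - e) * e) * (u + u ^ n * x ^ (n + 1)) := by ring
    _ = e * e * e + (1 - e) * (1 - e) := by rw [hee, ← he]; ring
    _ = 1 - (1 - e) * e * (2 + e) := by ring
    _ = 1 := by rw [hee]; ring

/-- A function on a smooth relative curve whose differential generates the differentials
is an étale coordinate. -/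
theorem etale_aeval_of_span_D_eq_top {A L : Type*} [CommRing A] [CommRing L] [Algebra A L]
    [Algebra.Smooth A L] (hrk : ∀ p, Module.rankAtStalk (R := L) Ω[L⁄A] p = 1) (t : L)
    (ht : Submodule.span L {D A L t} = ⊤) :
    (aeval t : A[X] →ₐ[A] L).toRingHom.Etale := by
  let := (aeval t : A[X] →ₐ[A] L).toRingHom.toAlgebra
  have : IsScalarTower A A[X] L :=
    .of_algebraMap_eq' (AlgHom.comp_algebraMap (aeval t : A[X] →ₐ[A] L)).symm
  have hX : algebraMap A[X] L X = t := aeval_X t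
  have hsurj : Function.Surjective (mapBaseChange A A[X] L) := by
    rw [← LinearMap.range_eq_top, eq_top_iff, ← ht, Submodule.span_le, Set.singleton_subset_iff]
    exact ⟨1 ⊗ₜ D A A[X] X, by simp [hX]⟩
  have hfree : Module.Free A[X] Ω[A[X]⁄A] := .of_equiv (polynomialEquiv A).symm
  have hfin : Module.Finite A[X] Ω[A[X]⁄A] := .equiv (polynomialEquiv A).symm
  -- A surjection between finite projective modules of equal rank is bijective.
  have hbij : Function.Bijective (mapBaseChange A A[X] L) := by
    refine Module.bijective_of_surjective_of_rankAtStalk_eq hsurj fun m hm ↦ ?_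
    have : Nontrivial A[X] := by
      refine nontrivial_of_ne (0 : A[X]) 1 fun h ↦ hm.ne_top ?_
      rw [Ideal.eq_top_iff_one, ← map_one (algebraMap A[X] L), ← h, map_zero]
      exact zero_mem _
    rw [hrk, Module.rankAtStalk_baseChange, Module.rankAtStalk_eq_of_equiv (polynomialEquiv A),
      Module.rankAtStalk_self]
    rfl
  have hsub : Subsingleton Ω[L⁄A[X]] := by
    refine subsingleton_of_forall_eq 0 fun x ↦ ?_
    obtain ⟨y, rfl⟩ := KaehlerDifferential.map_surjective A A[X] L x
    exact (KaehlerDifferential.exact_mapBaseChange_map A A[X] L y).mpr (hsurj y)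
  -- Jacobi–Zariski sequence: the injectivity above kills `δ`, and the preceding term vanishes
  -- because `L` is smooth over `A`.
  have hH1 : Subsingleton (Algebra.H1Cotangent A[X] L) := by
    refine subsingleton_of_forall_eq 0 fun x ↦ ?_
    have h0 : Algebra.H1Cotangent.δ A A[X] L x = 0 := by
      refine hbij.1 ?_
      rw [map_zero]
      exact (Algebra.H1Cotangent.exact_δ_mapBaseChange A A[X] L _).mpr ⟨x, rfl⟩
    obtain ⟨y, rfl⟩ := (Algebra.H1Cotangent.exact_map_δ A A[X] L x).mp h0
    rw [Subsingleton.elim y 0, map_zero]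
  have : Algebra.FormallyEtale A[X] L := ⟨hsub, hH1⟩
  exact (⟨this, .of_restrict_scalars_finitePresentation A _ _⟩ : Algebra.Etale A[X] L)

section Differentials

variable {A B : Type u} [CommRing A] [CommRing B] [Algebra A B]

theorem tmul_smul_quotient {M : Type*} [AddCommGroup M] [Module B M] (K : Ideal B) {k : B}
    (hk : k ∈ K) (x : M) : (1 : B ⧸ K) ⊗ₜ[B] (k • x) = 0 := by
  rw [← smul_tmul, Algebra.smul_def, mul_one, Ideal.Quotient.algebraMap_eq,
    Ideal.Quotient.eq_zero_iff_mem.mpr hk, zero_tmul]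

theorem tmul_D_eq_zero_of_mem_map (J : Ideal A) (K : Ideal B) (hJK : J.map (algebraMap A B) ≤ K)
    {x : B} (hx : x ∈ J.map (algebraMap A B)) : (1 : B ⧸ K) ⊗ₜ[B] D A B x = 0 := by
  induction hx using Submodule.span_induction with
  | mem x hx =>
    obtain ⟨a, -, rfl⟩ := hx
    simp
  | zero => simp
  | add x y _ _ hx hy => rw [map_add, tmul_add, hx, hy, add_zero]
  | smul b x hx h =>
    rw [smul_eq_mul, Derivation.leibniz, tmul_add, tmul_smul_quotient K (hJK hx), add_zero,
      tmul_smul, h, smul_zero]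

/-- If `t` generates `B` over `A` modulo `I + J B`, one can change `t` by an element of `I` so that
its differential generates the differentials modulo `I + J B`. -/
theorem exists_mem_span_tmul_D_add_eq_top [Algebra.Smooth A B]
    (hrk : ∀ p, Module.rankAtStalk (R := B) Ω[B⁄A] p = 1) (J : Ideal A) (I : Ideal B)
    [IsArtinianRing (B ⧸ I ⊔ J.map (algebraMap A B))] (t : B)
    (ht : ∀ x, ∃ p : A[X], x - aeval t p ∈ I ⊔ J.map (algebraMap A B)) :
    ∃ s ∈ I, Submodule.span (B ⧸ I ⊔ J.map (algebraMap A B))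
      {(1 : B ⧸ I ⊔ J.map (algebraMap A B)) ⊗ₜ[B] D A B (t + s)} = ⊤ := by
  set K := I ⊔ J.map (algebraMap A B) with hK
  let T := B ⧸ K
  obtain ⟨b⟩ : Nonempty (Module.Basis (Fin 1) T (T ⊗[B] Ω[B⁄A])) := by
    refine Module.nonempty_basis_of_flat_of_finrank_eq T _ 1 fun P ↦ ?_
    let := Ideal.Quotient.field P.asIdeal
    have h1 := Module.rankAtStalk_baseChange (R := T) (M := T ⊗[B] Ω[B⁄A]) (S := T ⧸ P.asIdeal) ⊥
    rw [Module.rankAtStalk_baseChange (R := B), hrk, Module.rankAtStalk_eq_finrank_of_free] at h1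
    exact h1
  let ε : T ⊗[B] Ω[B⁄A] ≃ₗ[T] T := b.repr ≪≫ₗ Finsupp.uniqueLinearEquiv T T (0 : Fin 1)
  -- The values `ε (ds)` for `s ∈ I` form an ideal: in `d(c s) = c ds + s dc` the last term vanishes
  -- modulo `K`.
  let N : Ideal T :=
    { carrier := {z | ∃ s ∈ I, ε (1 ⊗ₜ D A B s) = z}
      zero_mem' := ⟨0, zero_mem _, by simp⟩
      add_mem' := by
        rintro _ _ ⟨s, hs, rfl⟩ ⟨s', hs', rfl⟩
        exact ⟨s + s', add_mem hs hs', by simp [tmul_add]⟩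
      smul_mem' := by
        rintro c _ ⟨s, hs, rfl⟩
        obtain ⟨c, rfl⟩ := Ideal.Quotient.mk_surjective c
        refine ⟨c * s, Ideal.mul_mem_left _ _ hs, ?_⟩
        rw [Derivation.leibniz, tmul_add, tmul_smul_quotient K (Ideal.mem_sup_left hs), add_zero,
          ← smul_tmul, Algebra.smul_def, mul_one, smul_eq_mul, ← smul_eq_mul, ← map_smul,
          smul_tmul', smul_eq_mul, mul_one]
        rfl }
  -- Each `x` is `p(t) + s + j` with `s ∈ I`, `j ∈ J B`. Then `d(p(t))` is a multiple of `dt`, `ds`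
  -- contributes to `N`, and `dj` vanishes modulo `K`.
  have htop : N ⊔ Ideal.span {ε (1 ⊗ₜ D A B t)} = ⊤ := by
    set W := N ⊔ Ideal.span {ε (1 ⊗ₜ D A B t)} with hW
    have hD (x : B) : ε (1 ⊗ₜ D A B x) ∈ W := by
      obtain ⟨p, hp⟩ := ht x
      obtain ⟨s, hs, j, hj, hsj⟩ := Submodule.mem_sup.mp hp
      have hx : x = aeval t p + (s + j) := by rw [hsj]; ring
      rw [hx, map_add, map_add, tmul_add, tmul_add, map_add, map_add]
      refine add_mem ?_ (add_mem (Ideal.mem_sup_left ⟨s, hs, rfl⟩) ?_)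
      · rw [Derivation.map_aeval, ← smul_tmul, Algebra.smul_def, mul_one, ← mul_one (algebraMap _ _ _),
          ← smul_eq_mul, ← smul_tmul', map_smul]
        exact Submodule.smul_mem _ _ (Ideal.mem_sup_right (Ideal.mem_span_singleton_self _))
      · rw [tmul_D_eq_zero_of_mem_map J K le_sup_right hj, map_zero]
        exact zero_mem _
    have hΩ (ω : Ω[B⁄A]) : ε (1 ⊗ₜ ω) ∈ W := by
      have hω : ω ∈ Submodule.span B (Set.range (D A B)) := by
        rw [span_range_derivation]; trivial
      induction hω using Submodule.span_induction with
      | mem ω hω =>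
        obtain ⟨x, rfl⟩ := hω
        exact hD x
      | zero => simp
      | add ω ω' _ _ h h' => rw [tmul_add, map_add]; exact add_mem h h'
      | smul c ω _ h =>
        rw [← smul_tmul, Algebra.smul_def, ← smul_eq_mul, ← smul_tmul', map_smul]
        exact Submodule.smul_mem _ _ h
    have hz (z : T ⊗[B] Ω[B⁄A]) : ε z ∈ W := by
      induction z using TensorProduct.induction_on with
      | zero => simp
      | tmul c ω =>
        rw [← mul_one c, ← smul_eq_mul, ← smul_tmul', map_smul]
        exact Submodule.smul_mem _ _ (hΩ ω)
      | add z z' h h' => rw [map_add]; exact add_mem h h'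
    rw [Ideal.eq_top_iff_one, ← ε.apply_symm_apply 1]
    exact hz _
  obtain ⟨_, ⟨s, hs, rfl⟩, hu⟩ := exists_mem_isUnit_add_of_isArtinianRing _ _ htop
  refine ⟨s, hs, ?_⟩
  rw [← map_add, ← tmul_add, ← map_add] at hu
  obtain ⟨v, hv⟩ := hu.exists_left_inv
  refine eq_top_iff.mpr fun z _ ↦ Submodule.mem_span_singleton.mpr ⟨ε z * v, ε.injective ?_⟩
  rw [map_smul, smul_eq_mul, mul_assoc, hv, mul_one]

/-- Nakayama's lemma for differentials that are generated by one differential modulo `K`. -/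
theorem exists_sub_one_mem_and_forall_smul_mem_span_D [Module.Finite B Ω[B⁄A]] (K : Ideal B) (t : B)
    (ht : Submodule.span (B ⧸ K) {(1 : B ⧸ K) ⊗ₜ[B] D A B t} = ⊤) :
    ∃ h : B, h - 1 ∈ K ∧ ∀ ω : Ω[B⁄A], h • ω ∈ Submodule.span B {D A B t} := by
  let W := Submodule.span B {D A B t}
  have key (ω : Ω[B⁄A]) : ∃ c : B, ω - c • D A B t ∈ K • (⊤ : Submodule B Ω[B⁄A]) := by
    have : (1 : B ⧸ K) ⊗ₜ[B] ω ∈ Submodule.span (B ⧸ K) {(1 : B ⧸ K) ⊗ₜ[B] D A B t} := by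
      rw [ht]; trivial
    obtain ⟨c, hc⟩ := Submodule.mem_span_singleton.mp this
    obtain ⟨c, rfl⟩ := Ideal.Quotient.mk_surjective c
    refine ⟨c, ?_⟩
    rw [← Submodule.Quotient.mk_eq_zero,
      ← TensorProduct.quotTensorEquivQuotSMul_mk_one_tmul]
    rw [tmul_sub, ← hc, ← smul_tmul, Algebra.smul_def, smul_tmul', smul_eq_mul,
      Ideal.Quotient.algebraMap_eq, sub_self, map_zero]
  obtain ⟨h, hh, hz⟩ := Submodule.exists_sub_one_mem_and_smul_eq_zero_of_fg_of_le_smul K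
    (⊤ : Submodule B (Ω[B⁄A] ⧸ W)) Module.Finite.fg_top (by
      intro z _
      obtain ⟨ω, rfl⟩ := W.mkQ_surjective z
      obtain ⟨c, hc⟩ := key ω
      have h1 : W.mkQ ω = W.mkQ (ω - c • D A B t) := by
        rw [map_sub, eq_comm, sub_eq_self, Submodule.mkQ_apply, Submodule.Quotient.mk_eq_zero]
        exact Submodule.smul_mem _ _ (Submodule.mem_span_singleton_self _)
      rw [h1, ← Submodule.range_mkQ W, ← Submodule.map_top, ← Submodule.map_smul'']
      exact Submodule.mem_map_of_mem hc)
  refine ⟨h, hh, fun ω ↦ ?_⟩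
  have := hz (W.mkQ ω) trivial
  rwa [← map_smul, Submodule.mkQ_apply, Submodule.Quotient.mk_eq_zero] at this

theorem span_D_algebraMap_eq_top {L : Type u} [CommRing L] [Algebra A L] [Algebra B L]
    [IsScalarTower A B L] (M : Submonoid B) [IsLocalization M L] {h t : B}
    (hh : IsUnit (algebraMap B L h)) (ht : ∀ ω : Ω[B⁄A], h • ω ∈ Submodule.span B {D A B t}) :
    Submodule.span L {D A L (algebraMap B L t)} = ⊤ := by
  rw [eq_top_iff, ← span_range_map_derivation_of_isLocalization A B L M, Submodule.span_le]
  rintro _ ⟨x, rfl⟩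
  obtain ⟨c, hc⟩ := Submodule.mem_span_singleton.mp (ht (D A B x))
  obtain ⟨v, hv⟩ := hh.exists_left_inv
  refine Submodule.mem_span_singleton.mpr ⟨v * algebraMap B L c, ?_⟩
  have := congr_arg (KaehlerDifferential.map A A B L) hc
  rw [map_smul, map_smul, map_D, ← algebraMap_smul L c, ← algebraMap_smul L h] at this
  rw [mul_smul, this, smul_smul, hv, one_smul]
  rfl

theorem rankAtStalk_kaehlerDifferential_of_isLocalization [Algebra.Smooth A B] {L : Type u}
    [CommRing L] [Algebra A L] [Algebra B L] [IsScalarTower A B L] (M : Submonoid B)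
    [IsLocalization M L] (hrk : ∀ p, Module.rankAtStalk (R := B) Ω[B⁄A] p = 1) (p) :
    Module.rankAtStalk (R := L) Ω[L⁄A] p = 1 := by
  rw [Module.rankAtStalk_isBaseChange
    (IsLocalizedModule.isBaseChange M L (KaehlerDifferential.map A A B L)), hrk]

end Differentials

/-! ### Assembling the algebraic statement -/

/-- A quasi-finite algebra over an Artinian ring is finite, hence Artinian. -/
theorem isArtinianRing_quotient_sup_map {A B : Type*} [CommRing A] [CommRing B] [Algebra A B]
    (J : Ideal A) (I : Ideal B) [IsArtinianRing (A ⧸ J)] [Algebra.QuasiFinite A (B ⧸ I)] :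
    IsArtinianRing (B ⧸ I ⊔ J.map (algebraMap A B)) := by
  set K := I ⊔ J.map (algebraMap A B) with hK
  have hJK : J ≤ K.comap (algebraMap A B) :=
    Ideal.map_le_iff_le_comap.mp (le_sup_right (a := I))
  let : Algebra (A ⧸ J) (B ⧸ K) := (Ideal.quotientMap K (algebraMap A B) hJK).toAlgebra
  have : IsScalarTower A (A ⧸ J) (B ⧸ K) := .of_algebraMap_eq fun _ ↦ rfl
  have : Algebra.QuasiFinite A (B ⧸ K) :=
    .of_surjective_algHom (Ideal.Quotient.factorₐ A (le_sup_left : I ≤ K))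
      (Ideal.Quotient.factor_surjective le_sup_left)
  have : Algebra.QuasiFinite (A ⧸ J) (B ⧸ K) := .of_restrictScalars A _ _
  have : Module.Finite (A ⧸ J) (B ⧸ K) := .of_quasiFinite
  exact .of_finite (A ⧸ J) (B ⧸ K)

/-- Nakayama's lemma: an algebra that is finite over `A[t]` and generated by `t` modulo `J` is
generated by `t` after inverting some polynomial in `1 + J A[X]`. -/
theorem exists_sub_one_mem_and_forall_mul_eq_aeval {A S : Type*} [CommRing A] [CommRing S]
    [Algebra A S] [Algebra.FiniteType A S] (J : Ideal A) (t : S)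
    (hint : (aeval t : A[X] →ₐ[A] S).toRingHom.IsIntegral)
    (hgen : ∀ x, ∃ p : A[X], x - aeval t p ∈ J.map (algebraMap A S)) :
    ∃ r : A[X], r - 1 ∈ J.map (algebraMap A A[X]) ∧ ∀ x, ∃ p : A[X], aeval t r * x = aeval t p := by
  let := (aeval t : A[X] →ₐ[A] S).toRingHom.toAlgebra
  have : IsScalarTower A A[X] S :=
    .of_algebraMap_eq' (AlgHom.comp_algebraMap (aeval t : A[X] →ₐ[A] S)).symm
  have : Algebra.IsIntegral A[X] S := ⟨hint⟩
  have : Algebra.FiniteType A[X] S := .of_restrictScalars_finiteType A _ _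
  have : Module.Finite A[X] S := Algebra.IsIntegral.finite
  let W : Submodule A[X] S := LinearMap.range (Algebra.linearMap A[X] S)
  have hJ : ∀ x ∈ J.map (algebraMap A S),
      x ∈ J.map (algebraMap A A[X]) • (⊤ : Submodule A[X] S) := by
    intro x hx
    rw [Ideal.smul_top_eq_map, Ideal.map_map, ← IsScalarTower.algebraMap_eq]
    exact hx
  obtain ⟨r, hr, hz⟩ := Submodule.exists_sub_one_mem_and_smul_eq_zero_of_fg_of_le_smul
    (J.map (algebraMap A A[X])) (⊤ : Submodule A[X] (S ⧸ W)) Module.Finite.fg_top (by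
      intro z _
      obtain ⟨x, rfl⟩ := W.mkQ_surjective z
      obtain ⟨p, hp⟩ := hgen x
      have h1 : W.mkQ x = W.mkQ (x - aeval t p) := by
        rw [map_sub, eq_comm, sub_eq_self, Submodule.mkQ_apply, Submodule.Quotient.mk_eq_zero]
        exact ⟨p, rfl⟩
      rw [h1, ← Submodule.range_mkQ W, ← Submodule.map_top, ← Submodule.map_smul'']
      exact Submodule.mem_map_of_mem (hJ _ hp))
  refine ⟨r, hr, fun x ↦ ?_⟩
  have := hz (W.mkQ x) trivial
  rw [← map_smul, Submodule.mkQ_apply, Submodule.Quotient.mk_eq_zero] at this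
  obtain ⟨p, hp⟩ := this
  exact ⟨p, (Algebra.smul_def r x).symm.trans hp.symm⟩

theorem HasEtaleCoordinate.of_isIntegral_aeval {A B : Type u} [CommRing A] [CommRing B]
    [Algebra A B] [Algebra.Smooth A B] (hrk : ∀ p, Module.rankAtStalk (R := B) Ω[B⁄A] p = 1)
    (J : Ideal A) (I : Ideal B) [IsArtinianRing (A ⧸ J)] [Algebra.QuasiFinite A (B ⧸ I)] (t : B)
    (hint : (aeval (Ideal.Quotient.mk I t) : A[X] →ₐ[A] B ⧸ I).toRingHom.IsIntegral)
    (hgen : ∀ x, ∃ p : A[X],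
      x - aeval (Ideal.Quotient.mk I t) p ∈ J.map (algebraMap A (B ⧸ I))) :
    HasEtaleCoordinate A J I := by
  have := isArtinianRing_quotient_sup_map J I
  have haeval (u : B) (p : A[X]) :
      aeval (Ideal.Quotient.mk I u) p = Ideal.Quotient.mk I (aeval u p) :=
    aeval_algHom_apply (Ideal.Quotient.mkₐ A I) u p
  obtain ⟨s, hs, hspan⟩ := exists_mem_span_tmul_D_add_eq_top hrk J I t fun x ↦ by
    obtain ⟨p, hp⟩ := hgen (Ideal.Quotient.mk I x)
    refine ⟨p, ?_⟩
    rw [haeval, ← map_sub, IsScalarTower.algebraMap_eq A B (B ⧸ I), ← Ideal.map_map,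
      Ideal.Quotient.algebraMap_eq, ← Ideal.mem_comap,
      Ideal.comap_map_of_surjective' _ Ideal.Quotient.mk_surjective, Ideal.mk_ker, sup_comm] at hp
    exact hp
  set u := t + s with hu
  have hut : Ideal.Quotient.mk I u = Ideal.Quotient.mk I t := by
    rw [hu, map_add, Ideal.Quotient.eq_zero_iff_mem.mpr hs, add_zero]
  rw [← hut] at hint hgen
  clear_value u
  set K := I ⊔ J.map (algebraMap A B) with hK
  obtain ⟨h, hhK, hh⟩ := exists_sub_one_mem_and_forall_smul_mem_span_D K u hspan
  obtain ⟨r₀, hr₀, hr₀S⟩ := exists_sub_one_mem_and_forall_mul_eq_aeval J _ hint hgen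
  obtain ⟨p₁, hp₁⟩ := hr₀S (Ideal.Quotient.mk I h)
  set φ : A[X] →ₐ[A] B := aeval u with hφ
  -- The element `h` need not be a polynomial in `u`, but modulo `I` one has `φ r₀ * h = φ p₁`. So
  -- on `V(I)` inverting `F` amounts to inverting the polynomial `r₀ * p₁`, as an immersion with
  -- closed image in `D(r₀ * p₁)` requires.
  let F : B := h * φ (r₀ * p₁)
  have hFK : F - 1 ∈ K := by
    have h1 : Ideal.Quotient.mk K h = 1 := by
      rw [← map_one (Ideal.Quotient.mk K)]; exact Ideal.Quotient.eq.mpr hhK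
    have h2 : Ideal.Quotient.mk K (φ r₀) = 1 := by
      rw [← map_one (Ideal.Quotient.mk K)]
      refine Ideal.Quotient.eq.mpr (Ideal.mem_sup_right ?_)
      have := Ideal.mem_map_of_mem φ.toRingHom hr₀
      rw [Ideal.map_map, AlgHom.toRingHom_eq_coe, AlgHom.comp_algebraMap] at this
      simpa using this
    have h3 : Ideal.Quotient.mk K (φ p₁) = Ideal.Quotient.mk K (φ r₀ * h) := by
      rw [haeval, haeval, ← map_mul, eq_comm] at hp₁
      exact Ideal.Quotient.eq.mpr (Ideal.mem_sup_left (Ideal.Quotient.eq.mp hp₁))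
    rw [← Ideal.Quotient.eq_zero_iff_mem]
    simp only [F, map_sub, map_mul, h1, h2, h3, map_one, mul_one, sub_self]
  let L := Localization.Away F
  have hFL : IsUnit (algebraMap B L F) := IsLocalization.Away.algebraMap_isUnit F
  have hhL : IsUnit (algebraMap B L h) := by
    simp only [F, map_mul] at hFL; exact isUnit_of_mul_isUnit_left hFL
  have hrL : IsUnit (algebraMap B L (φ (r₀ * p₁))) := by
    rw [map_mul] at hFL; exact isUnit_of_mul_isUnit_right hFL
  have hφL (p : A[X]) : aeval (algebraMap B L u) p = algebraMap B L (φ p) :=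
    aeval_algebraMap_apply L u p
  have : Algebra.Smooth B L := .of_isLocalization_Away F
  have : Algebra.Smooth A L := .comp A B L
  refine HasEtaleCoordinate.of_away L F hFK
    (.of_etale J _ (r₀ * p₁) (aeval (algebraMap B L u)) (by rwa [hφL])
      (etale_aeval_of_span_D_eq_top
        (rankAtStalk_kaehlerDifferential_of_isLocalization (.powers F) hrk) _
        (span_D_algebraMap_eq_top (.powers F) hhL hh)) fun x ↦ ?_)
  obtain ⟨k, y, hy⟩ := IsLocalization.Away.surj F x
  obtain ⟨p, hp⟩ := hr₀S (Ideal.Quotient.mk I y)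
  -- Modulo `I`, `F` equals `φ p₁ ^ 2`, so `φ p₁ ^ (2 * k)` clears the denominator `F ^ k` of `x`;
  -- one further `φ r₀` turns the numerator `y` into `φ p`.
  refine ⟨r₀ ^ (2 * k) * p₁ * p, 2 * k + 1, ?_⟩
  rw [hφL, hφL, ← Ideal.Quotient.eq_zero_iff_mem, map_sub, sub_eq_zero]
  let q : B →+* L ⧸ I.map (algebraMap B L) := (Ideal.Quotient.mk _).comp (algebraMap B L)
  have hq {a b : B} (hab : Ideal.Quotient.mk I a = Ideal.Quotient.mk I b) : q a = q b :=
    Ideal.Quotient.eq.mpr (by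
      rw [← map_sub]; exact Ideal.mem_map_of_mem _ (Ideal.Quotient.eq.mp hab))
  have e1 : q (φ r₀) * q h = q (φ p₁) := by
    rw [← map_mul]; apply hq; rw [map_mul, ← haeval, ← haeval]; exact hp₁
  have e2 : q (φ r₀) * q y = q (φ p) := by
    rw [← map_mul]; apply hq; rw [map_mul, ← haeval, ← haeval]; exact hp
  have e3 : Ideal.Quotient.mk (I.map (algebraMap B L)) x * (q h * (q (φ r₀) * q (φ p₁))) ^ k =
      q y := by
    have := congr_arg (Ideal.Quotient.mk (I.map (algebraMap B L))) hy
    simp only [F, map_mul, map_pow] at this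
    exact this
  simp only [map_mul, map_pow]
  change (q (φ r₀) * q (φ p₁)) ^ (2 * k + 1) * Ideal.Quotient.mk _ x =
    q (φ r₀) ^ (2 * k) * q (φ p₁) * q (φ p)
  rw [← e2, ← e3, ← e1]
  ring

/-- The algebraic form of the theorem. -/
theorem hasEtaleCoordinate_of_quasiFinite {A B : Type u} [CommRing A] [CommRing B]
    [Finite (MaximalSpectrum A)] [Algebra A B] [Algebra.Smooth A B]
    (hrk : ∀ p, Module.rankAtStalk (R := B) Ω[B⁄A] p = 1) (I : Ideal B)
    [Algebra.QuasiFinite A (B ⧸ I)]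
    (hgen : ∀ m : MaximalSpectrum A, ∃ τ : B ⧸ I, ∀ s, ∃ p : A[X],
      s - aeval τ p ∈ m.asIdeal.map (algebraMap A (B ⧸ I))) :
    HasEtaleCoordinate A (⊥ : Ideal A).jacobson I := by
  set J := (⊥ : Ideal A).jacobson with hJ
  obtain ⟨τ, hτ⟩ := exists_forall_sub_aeval_mem_map_jacobson hgen
  obtain ⟨b, hb, -, hint⟩ := exists_sub_one_mem_and_forall_isIntegral_pow_mul (S := B ⧸ I) J
  obtain ⟨b, rfl⟩ := Ideal.Quotient.mk_surjective b
  have hbK : b - 1 ∈ I ⊔ J.map (algebraMap A B) := by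
    rw [← map_one (Ideal.Quotient.mk I), ← map_sub, IsScalarTower.algebraMap_eq A B (B ⧸ I),
      ← Ideal.map_map, Ideal.Quotient.algebraMap_eq, ← Ideal.mem_comap,
      Ideal.comap_map_of_surjective' _ Ideal.Quotient.mk_surjective, Ideal.mk_ker, sup_comm] at hb
    exact hb
  let L := Localization.Away b
  obtain ⟨t, ht, htgen⟩ := exists_isIntegral_aeval_and_forall_sub_aeval_mem J
    (quotientMapExtension (A := A) L I) _ _ (quotientMapExtension_mul_invSelf L I b)
    (exists_eq_quotientMapExtension_mul_pow L I b) hb hint τ hτ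
  obtain ⟨t, rfl⟩ := Ideal.Quotient.mk_surjective t
  have : Algebra.Smooth B L := .of_isLocalization_Away b
  have : Algebra.Smooth A L := .comp A B L
  have := quasiFinite_quotient_map_of_away (A := A) L I b
  exact .of_away L b hbK (.of_isIntegral_aeval
    (rankAtStalk_kaehlerDifferential_of_isLocalization (.powers b) hrk) J _ t ht htgen)

/-- The rank is local, and on a standard smooth neighbourhood the differentials are free of rank
`n`. -/
theorem rankAtStalk_kaehlerDifferential_of_locally {A B : Type u} [CommRing A] [CommRing B]
    [Algebra A B] [Algebra.Smooth A B] (n : ℕ)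
    (h : RingHom.Locally (fun f ↦ RingHom.IsStandardSmoothOfRelativeDimension n f)
      (algebraMap A B)) (p : PrimeSpectrum B) :
    Module.rankAtStalk (R := B) Ω[B⁄A] p = n := by
  obtain ⟨s, hs, H⟩ := h
  obtain ⟨t, hts, htp⟩ : ∃ t ∈ s, t ∉ p.asIdeal := by
    by_contra! hcon
    exact p.2.ne_top (eq_top_iff.mpr (hs ▸ Ideal.span_le.mpr hcon))
  let L := Localization.Away t
  have hL : Algebra.IsStandardSmoothOfRelativeDimension n A L := by
    have := H t hts
    rw [← IsScalarTower.algebraMap_eq A B L] at this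
    rwa [RingHom.isStandardSmoothOfRelativeDimension_algebraMap] at this
  have := Algebra.IsStandardSmoothOfRelativeDimension.isStandardSmooth (R := A) (S := L) n
  obtain ⟨q, rfl⟩ : p ∈ Set.range (PrimeSpectrum.comap (algebraMap B L)) := by
    rw [PrimeSpectrum.localization_away_comap_range L t]
    exact htp
  have : Nontrivial L := q.nontrivial
  rw [← Module.rankAtStalk_isBaseChange
    (IsLocalizedModule.isBaseChange (.powers t) L (KaehlerDifferential.map A A B L)),
    Module.rankAtStalk_eq_finrank_of_free, Module.finrank,
    Algebra.IsStandardSmoothOfRelativeDimension.rank_kaehlerDifferential n]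
  simp

/-! ### From rings to schemes -/

theorem isPushout_quotientMk {R S : Type u} [CommRing R] [CommRing S] (f : R →+* S) (I : Ideal R) :
    IsPushout (CommRingCat.ofHom f) (CommRingCat.ofHom (Ideal.Quotient.mk I))
      (CommRingCat.ofHom (Ideal.Quotient.mk (I.map f)))
      (CommRingCat.ofHom (Ideal.quotientMap (I.map f) f Ideal.le_comap_map)) := by
  refine ⟨⟨by ext; simp⟩, ⟨PushoutCocone.IsColimit.mk _
    (fun s ↦ CommRingCat.ofHom (Ideal.Quotient.lift (I.map f) s.inl.hom ?_)) ?_ ?_ ?_⟩⟩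
  · have hle : I.map f ≤ RingHom.ker s.inl.hom := by
      rw [Ideal.map_le_iff_le_comap]
      intro x hx
      have := congr($(s.condition).hom x)
      simp only [CommRingCat.hom_comp, CommRingCat.hom_ofHom, RingHom.comp_apply,
        Ideal.Quotient.eq_zero_iff_mem.mpr hx, map_zero] at this
      exact this
    exact fun a ha ↦ hle ha
  · intro s; ext x; rfl
  · intro s
    ext x
    exact congr($(s.condition).hom x)
  · intro s m h1 h2
    ext x
    exact congr($(h1).hom x)

/-- The ring form of the Cartesian square: `L ⧸ I` is the quotient of `R` by `I.comap ψ`, and its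
base change to `L` is `L` modulo the extension of that ideal, which is `I` again. -/
theorem isPushout_id_quotientMk {R L : Type u} [CommRing R] [CommRing L] (ψ : R →+* L) (I : Ideal L)
    (hsurj : Function.Surjective ((Ideal.Quotient.mk I).comp ψ)) (hI : I ≤ (I.comap ψ).map ψ) :
    IsPushout (CommRingCat.ofHom ψ) (CommRingCat.ofHom ((Ideal.Quotient.mk I).comp ψ))
      (CommRingCat.ofHom (Ideal.Quotient.mk I)) (𝟙 (CommRingCat.of (L ⧸ I))) := by
  have key (s : PushoutCocone (CommRingCat.ofHom ψ)
      (CommRingCat.ofHom ((Ideal.Quotient.mk I).comp ψ))) :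
      CommRingCat.ofHom (Ideal.Quotient.mk I) ≫ s.inr = s.inl := by
    have hle : I ≤ RingHom.ker s.inl.hom := by
      refine hI.trans ?_
      rw [Ideal.map_le_iff_le_comap]
      intro x hx
      have := congr($(s.condition).hom x)
      simp only [CommRingCat.hom_comp, CommRingCat.hom_ofHom, RingHom.comp_apply,
        Ideal.Quotient.eq_zero_iff_mem.mpr (Ideal.mem_comap.mp hx), map_zero] at this
      exact this
    ext x
    obtain ⟨z, hz⟩ := hsurj (Ideal.Quotient.mk I x)
    have h1 := congr($(s.condition).hom z)
    simp only [CommRingCat.hom_comp, CommRingCat.hom_ofHom, RingHom.comp_apply] at h1 hz ⊢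
    rw [← hz, ← h1, ← sub_eq_zero, ← map_sub]
    exact hle (Ideal.Quotient.eq.mp hz)
  refine ⟨⟨by ext; simp⟩, ⟨PushoutCocone.IsColimit.mk _ (fun s ↦ s.inr) key ?_ ?_⟩⟩
  · intro s; simp
  · intro s m _ h2; simpa using h2

/-- The affine line over `Spec R` is the spectrum of the polynomial ring. -/
def affineLineIso (R : Type u) [CommRing R] : affineLine R ≅ Spec (CommRingCat.of R[X]) :=
  AffineSpace.SpecIso PUnit.{u + 1} (CommRingCat.of R) ≪≫
    Scheme.Spec.mapIso (MvPolynomial.uniqueAlgEquiv R PUnit.{u + 1}).symm.toRingEquiv.toCommRingCatIso.op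

theorem affineLineIso_inv_over (R : Type u) [CommRing R] :
    (affineLineIso R).inv ≫ affineLineToSpec R =
      Spec.map (CommRingCat.ofHom (algebraMap R R[X])) := by
  rw [affineLineIso, Iso.trans_inv, Category.assoc, AffineSpace.SpecIso_inv_over]
  simp only [Functor.mapIso_inv, Scheme.Spec_map, Iso.op_inv, Quiver.Hom.unop_op]
  rw [← Spec.map_comp]
  congr 1
  ext x
  simp

theorem affineLineIso_hom_over (R : Type u) [CommRing R] :
    (affineLineIso R).hom ≫ Spec.map (CommRingCat.ofHom (algebraMap R R[X])) =
      affineLineToSpec R := by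
  rw [← affineLineIso_inv_over, Iso.hom_inv_id_assoc]

/-- A closed immersion of the fibre `Spec (S ⧸ 𝔪 S)` into the affine line gives a generator
of `S ⧸ 𝔪 S`. -/
theorem exists_generator_of_isClosedImmersion {A S : Type u} [CommRing A] [CommRing S] [Algebra A S]
    (m : MaximalSpectrum A) {Y : Scheme.{u}} (q : Y ⟶ Spec (CommRingCat.of A))
    (e : Y ≅ Spec (CommRingCat.of S))
    (he : e.hom ≫ Spec.map (CommRingCat.ofHom (algebraMap A S)) = q)
    (ι : closedFibre q m ⟶ affineLine (A ⧸ m.asIdeal)) [IsClosedImmersion ι]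
    (hι : ι ≫ affineLineToSpec (A ⧸ m.asIdeal) = closedFibreToSpec q m) :
    ∃ τ : S, ∀ s, ∃ p : A[X], s - aeval τ p ∈ m.asIdeal.map (algebraMap A S) := by
  let mS := m.asIdeal.map (algebraMap A S)
  let ρ : A ⧸ m.asIdeal →+* S ⧸ mS :=
    Ideal.quotientMap mS (algebraMap A S) Ideal.le_comap_map
  have hpb : IsPullback
      (Spec.map (CommRingCat.ofHom (Ideal.Quotient.mk mS)) ≫ e.inv)
      (Spec.map (CommRingCat.ofHom ρ)) q (closedPoint m) := by
    refine (isPullback_SpecMap_of_isPushout _ _ _ _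
      (isPushout_quotientMk (algebraMap A S) m.asIdeal)).of_iso
      (Iso.refl _) e.symm (Iso.refl _) (Iso.refl _) ?_ ?_ ?_ ?_ <;> simp [← he]
  let w : Spec (CommRingCat.of (S ⧸ mS)) ≅ closedFibre q m := hpb.isoPullback
  obtain ⟨θ, hθ⟩ := Spec.map_surjective (w.hom ≫ ι ≫ (affineLineIso (A ⧸ m.asIdeal)).hom)
  have hsurj : Function.Surjective θ.hom := by
    have : IsClosedImmersion (Spec.map θ) := by rw [hθ]; infer_instance
    have h1 := (IsClosedImmersion.isAffine_surjective_of_isAffine (Spec.map θ)).2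
    have h2 : θ = (Scheme.ΓSpecIso _).inv ≫ (Spec.map θ).appTop ≫ (Scheme.ΓSpecIso _).hom := by
      rw [Scheme.ΓSpecIso_naturality, Iso.inv_hom_id_assoc]
    rw [h2, CommRingCat.hom_comp, CommRingCat.hom_comp]
    exact ((Scheme.ΓSpecIso _).commRingCatIsoToRingEquiv.surjective.comp h1).comp
      (Scheme.ΓSpecIso _).symm.commRingCatIsoToRingEquiv.surjective
  have hC : θ.hom.comp (algebraMap (A ⧸ m.asIdeal) (A ⧸ m.asIdeal)[X]) = ρ := by
    have : CommRingCat.ofHom (algebraMap (A ⧸ m.asIdeal) (A ⧸ m.asIdeal)[X]) ≫ θ =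
        CommRingCat.ofHom ρ := by
      apply Spec.map_injective
      rw [Spec.map_comp, hθ, Category.assoc, Category.assoc, affineLineIso_hom_over, hι]
      exact hpb.isoPullback_hom_snd
    exact congr($(this).hom)
  -- The generator is a lift of the coordinate function pulled back along the immersion.
  obtain ⟨τ, hτ⟩ := Ideal.Quotient.mk_surjective (θ.hom X)
  refine ⟨τ, fun s ↦ ?_⟩
  obtain ⟨p, hp⟩ := hsurj (Ideal.Quotient.mk mS s)
  obtain ⟨p, rfl⟩ := Polynomial.map_surjective _ Ideal.Quotient.mk_surjective p
  refine ⟨p, Ideal.Quotient.eq.mp ?_⟩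
  have key : θ.hom.comp (mapRingHom (Ideal.Quotient.mk m.asIdeal)) =
      (Ideal.Quotient.mk mS).comp (aeval τ : A[X] →ₐ[A] S).toRingHom := by
    refine Polynomial.ringHom_ext (fun a ↦ ?_) ?_
    · have := congr($hC (Ideal.Quotient.mk _ a))
      simp at this ⊢
      exact this
    · simp [hτ]
  rw [← hp]
  exact congr($key p)

theorem exists_open_of_hasEtaleCoordinate {A B : Type u} [CommRing A] [CommRing B] [Algebra A B]
    (I : Ideal B) (h : HasEtaleCoordinate A (⊥ : Ideal A).jacobson I)
    {C : Scheme.{u}} (p : C ⟶ Spec (CommRingCat.of A)) {Y : Scheme.{u}} (i : Y ⟶ C)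
    (c : C ≅ Spec (CommRingCat.of B))
    (hc : c.hom ≫ Spec.map (CommRingCat.ofHom (algebraMap A B)) = p)
    (y : Y ≅ Spec (CommRingCat.of (B ⧸ I)))
    (hy : i ≫ c.hom = y.hom ≫ Spec.map (CommRingCat.ofHom (Ideal.Quotient.mk I))) :
    ∃ (C' : C.Opens) (V : (affineLine A).Opens) (f : C'.toScheme ⟶ V.toScheme)
      (Y' : Scheme.{u}) (j : Y' ⟶ V.toScheme) (e : (i ⁻¹ᵁ C').toScheme ⟶ Y'),
      IsAffineOpen C' ∧
      (∀ m : MaximalSpectrum A, Set.range (closedFibreι (i ≫ p) m ≫ i) ⊆ (C' : Set C)) ∧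
      IsAffineOpen V ∧
      Etale f ∧
      f ≫ V.ι ≫ affineLineToSpec A = C'.ι ≫ p ∧
      IsClosedImmersion j ∧
      IsIso e ∧
      IsPullback (i ∣_ C') e f j := by
  obtain ⟨L, _, _, _, _, r, φ, hL, hrange, hr, hφ, hsurj, hI⟩ := h
  let R' := Localization.Away r
  let IL := I.map (algebraMap B L)
  have hu : ∀ y : Submonoid.powers r, IsUnit (φ y) := by
    rintro ⟨_, n, rfl⟩
    simpa using hr.pow n
  let ψ : R' →ₐ[A] L := IsLocalization.liftAlgHom (M := Submonoid.powers r) (f := φ) hu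
  have hψφ (x : A[X]) : ψ (algebraMap A[X] R' x) = φ x := IsLocalization.lift_eq hu x
  have hψsurj : Function.Surjective ((Ideal.Quotient.mk IL).comp ψ.toRingHom) := by
    intro x
    obtain ⟨x, rfl⟩ := Ideal.Quotient.mk_surjective x
    obtain ⟨q, n, hqn⟩ := hsurj x
    refine ⟨IsLocalization.mk' _ q (⟨r ^ n, n, rfl⟩ : Submonoid.powers r), ?_⟩
    refine ((hr.pow n).map (Ideal.Quotient.mk IL)).mul_left_cancel ?_
    rw [← map_mul, Ideal.Quotient.eq.mpr hqn, RingHom.comp_apply, ← map_mul, ← map_pow, ← hψφ]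
    congr 1
    change ψ _ * ψ _ = _
    rw [← map_mul, ← hψφ, mul_comm]
    congr 1
    exact IsLocalization.mk'_spec R' q (⟨r ^ n, n, rfl⟩ : Submonoid.powers r)
  have hψI : IL ≤ (IL.comap ψ.toRingHom).map ψ.toRingHom := by
    refine hI.trans (Ideal.map_le_iff_le_comap.mpr fun q hq ↦ ?_)
    have : ψ.toRingHom (algebraMap A[X] R' q) ∈ (IL.comap ψ.toRingHom).map ψ.toRingHom :=
      Ideal.mem_map_of_mem _ (by rw [Ideal.mem_comap]; exact (hψφ q).symm ▸ hq)
    rw [Ideal.mem_comap, ← hψφ]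
    exact this
  have hψet : ψ.toRingHom.Etale := by
    let := φ.toRingHom.toAlgebra
    let := ψ.toRingHom.toAlgebra
    have : IsScalarTower A[X] R' L := .of_algebraMap_eq fun x ↦ (hψφ x).symm
    have : Algebra.Etale A[X] L := hφ
    have : Algebra.Etale A[X] R' := .of_isLocalizationAway r
    exact Algebra.Etale.of_restrictScalars A[X] R' L
  have hopen : IsOpenImmersion (Spec.map (CommRingCat.ofHom (algebraMap B L))) := by
    obtain ⟨b, hb⟩ := hL.exists_away
    exact IsOpenImmersion.of_isLocalization b
  let g : Spec (CommRingCat.of L) ⟶ C := Spec.map (CommRingCat.ofHom (algebraMap B L)) ≫ c.inv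
  let v : Spec (CommRingCat.of R') ⟶ affineLine A :=
    Spec.map (CommRingCat.ofHom (algebraMap A[X] R')) ≫ (affineLineIso A).inv
  have hv : IsOpenImmersion (Spec.map (CommRingCat.ofHom (algebraMap A[X] R'))) :=
    IsOpenImmersion.of_isLocalization r
  let f : g.opensRange.toScheme ⟶ v.opensRange.toScheme :=
    g.isoOpensRange.inv ≫ Spec.map (CommRingCat.ofHom ψ.toRingHom) ≫ v.isoOpensRange.hom
  have hpbY : IsPullback (Spec.map (CommRingCat.ofHom (Ideal.Quotient.mk IL)))
      (Spec.map (CommRingCat.ofHom (Ideal.quotientMap IL (algebraMap B L) Ideal.le_comap_map)) ≫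
        y.inv) g i := by
    refine (isPullback_SpecMap_of_isPushout _ _ _ _ (isPushout_quotientMk (algebraMap B L) I)).of_iso
      (Iso.refl _) (Iso.refl _) y.symm c.symm ?_ ?_ ?_ ?_
    · simp
    · simp
    · simp [g]
    · rw [Iso.symm_hom, Iso.symm_hom, Iso.eq_inv_comp, ← Category.assoc, ← hy, Category.assoc,
        Iso.hom_inv_id, Category.comp_id]
  have hpbZ : IsPullback (i ∣_ g.opensRange) (i ⁻¹ᵁ g.opensRange).ι g.opensRange.ι i :=
    isPullback_morphismRestrict i g.opensRange
  have hpbY' : IsPullback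
      (Spec.map (CommRingCat.ofHom (Ideal.Quotient.mk IL)) ≫ g.isoOpensRange.hom)
      (Spec.map (CommRingCat.ofHom (Ideal.quotientMap IL (algebraMap B L) Ideal.le_comap_map)) ≫
        y.inv) g.opensRange.ι i :=
    hpbY.of_iso (Iso.refl _) g.isoOpensRange (Iso.refl _) (Iso.refl _)
      (by simp) (by simp) (by simp) (by simp)
  let z : Spec (CommRingCat.of (L ⧸ IL)) ≅ (i ⁻¹ᵁ g.opensRange).toScheme :=
    hpbY'.isoIsPullback _ _ hpbZ
  have hz : z.hom ≫ (i ∣_ g.opensRange) =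
      Spec.map (CommRingCat.ofHom (Ideal.Quotient.mk IL)) ≫ g.isoOpensRange.hom := by
    simp [z]
  have hj : z.hom ≫ (i ∣_ g.opensRange) ≫ f =
      Spec.map (CommRingCat.ofHom ((Ideal.Quotient.mk IL).comp ψ.toRingHom)) ≫
        v.isoOpensRange.hom := by
    have h0 : Spec.map (CommRingCat.ofHom ((Ideal.Quotient.mk IL).comp ψ.toRingHom)) =
        Spec.map (CommRingCat.ofHom (Ideal.Quotient.mk IL)) ≫
          Spec.map (CommRingCat.ofHom ψ.toRingHom) := by
      rw [CommRingCat.ofHom_comp, Spec.map_comp]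
    rw [← Category.assoc, hz, h0]
    simp [f]
  -- `Y'` is `Y ∩ C'` itself, embedded in `V` through `f`, so `e` is the identity.
  refine ⟨g.opensRange, v.opensRange, f, _, (i ∣_ g.opensRange) ≫ f, 𝟙 _,
    isAffineOpen_opensRange g, fun m ↦ ?_, isAffineOpen_opensRange v, ?_, ?_, ?_, inferInstance, ?_⟩
  · rintro _ ⟨x, rfl⟩
    set x' : Y := closedFibreι (i ≫ p) m x with hx'
    have h1 : (c.hom (i x')) = Spec.map (CommRingCat.ofHom (Ideal.Quotient.mk I)) (y.hom x') := by
      rw [← Scheme.Hom.comp_apply, hy, Scheme.Hom.comp_apply]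
    have h2 : Spec.map (CommRingCat.ofHom (algebraMap A B)) (c.hom (i x')) =
        closedPoint m (closedFibreToSpec (i ≫ p) m x) := by
      rw [← Scheme.Hom.comp_apply, hc, ← Scheme.Hom.comp_apply, hx', ← Scheme.Hom.comp_apply,
        pullback.condition, Scheme.Hom.comp_apply]
    -- A point of a closed fibre of `Y` is a prime containing `I` and `𝔪 B`, hence `J B`.
    obtain ⟨Q, hQ, hQP⟩ := hrange (c.hom (i x')).asIdeal (c.hom (i x')).isPrime (by
        rw [h1]
        intro a ha
        change Ideal.Quotient.mk I a ∈ (y.hom x').asIdeal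
        rw [Ideal.Quotient.eq_zero_iff_mem.mpr ha]
        exact zero_mem _) (by
        rw [Ideal.map_le_iff_le_comap]
        change _ ≤ (Spec.map (CommRingCat.ofHom (algebraMap A B)) (c.hom (i x'))).asIdeal
        rw [h2]
        intro a ha
        change Ideal.Quotient.mk m.asIdeal a ∈ (closedFibreToSpec (i ≫ p) m x).asIdeal
        rw [Ideal.Quotient.eq_zero_iff_mem.mpr (Ideal.mem_sInf.mp ha ⟨bot_le, m.isMaximal⟩)]
        exact zero_mem _)
    obtain ⟨Q', hQ'⟩ : ∃ Q' : ↥(Spec (CommRingCat.of L)),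
        Spec.map (CommRingCat.ofHom (algebraMap B L)) Q' = c.hom (i x') :=
      ⟨⟨Q, hQ⟩, PrimeSpectrum.ext hQP⟩
    refine ⟨Q', ?_⟩
    change (Spec.map (CommRingCat.ofHom (algebraMap B L)) ≫ c.inv) Q' = i x'
    rw [Scheme.Hom.comp_apply, hQ', ← Scheme.Hom.comp_apply, Iso.hom_inv_id]
    rfl
  · have : Etale (Spec.map (CommRingCat.ofHom ψ.toRingHom)) :=
      (HasRingHomProperty.Spec_iff (P := @Etale)).mpr hψet
    infer_instance
  · have h1 : CommRingCat.ofHom (algebraMap A A[X]) ≫ CommRingCat.ofHom (algebraMap A[X] R') ≫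
        CommRingCat.ofHom ψ.toRingHom =
        CommRingCat.ofHom (algebraMap A B) ≫ CommRingCat.ofHom (algebraMap B L) := by
      ext a
      change ψ (algebraMap A[X] R' (algebraMap A A[X] a)) = algebraMap B L (algebraMap A B a)
      rw [hψφ, AlgHom.commutes, IsScalarTower.algebraMap_apply A B L]
    rw [← cancel_epi g.isoOpensRange.hom, ← hc]
    simp only [f, Category.assoc, Iso.hom_inv_id_assoc, Scheme.Hom.isoOpensRange_hom_ι_assoc, g, v,
      affineLineIso_inv_over, Iso.inv_hom_id_assoc, ← Spec.map_comp, ← h1]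
  · have h1 : IsClosedImmersion
        (Spec.map (CommRingCat.ofHom ((Ideal.Quotient.mk IL).comp ψ.toRingHom))) :=
      IsClosedImmersion.spec_of_surjective _ hψsurj
    have h2 : IsClosedImmersion (z.hom ≫ (i ∣_ g.opensRange) ≫ f) := by
      rw [hj]; infer_instance
    exact (MorphismProperty.cancel_left_of_respectsIso @IsClosedImmersion z.hom _).mp h2
  · have h1 := isPullback_SpecMap_of_isPushout _ _ _ _ (isPushout_id_quotientMk ψ.toRingHom IL hψsurj hψI)
    refine h1.of_iso z g.isoOpensRange z v.isoOpensRange hz.symm ?_ ?_ ?_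
    · rw [Spec.map_id, Category.id_comp, Category.comp_id]
    · simp [f]
    · rw [hj]

end Reembed

end

theorem mainTheorem8 {A : Type u} [CommRing A] [Finite (MaximalSpectrum A)]
    {C : Scheme.{u}} [IsAffine C] (p : C ⟶ Spec (CommRingCat.of A))
    [SmoothOfRelativeDimension 1 p]
    {Y : Scheme.{u}} (i : Y ⟶ C) [IsClosedImmersion i] [LocallyQuasiFinite (i ≫ p)]
    (ι : ∀ m : MaximalSpectrum A,
      Reembed.closedFibre (i ≫ p) m ⟶ Reembed.affineLine (A ⧸ m.asIdeal))
    (_hι_closed : ∀ m : MaximalSpectrum A, IsClosedImmersion (ι m))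
    (_hι_over : ∀ m : MaximalSpectrum A,
      ι m ≫ Reembed.affineLineToSpec (A ⧸ m.asIdeal) =
        Reembed.closedFibreToSpec (i ≫ p) m) :
    ∃ (C' : C.Opens) (V : (Reembed.affineLine A).Opens) (f : C'.toScheme ⟶ V.toScheme)
      (Y' : Scheme.{u}) (j : Y' ⟶ V.toScheme) (e : (i ⁻¹ᵁ C').toScheme ⟶ Y'),
      IsAffineOpen C' ∧
      (∀ m : MaximalSpectrum A,
        Set.range (Reembed.closedFibreι (i ≫ p) m ≫ i) ⊆ (C' : Set C)) ∧
      IsAffineOpen V ∧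
      Etale f ∧
      f ≫ V.ι ≫ Reembed.affineLineToSpec A = C'.ι ≫ p ∧
      IsClosedImmersion j ∧
      IsIso e ∧
      IsPullback (i ∣_ C') e f j := by
  obtain ⟨φ, hφ⟩ := Spec.map_surjective (C.isoSpec.inv ≫ p)
  have hdim : SmoothOfRelativeDimension 1 (Spec.map φ) := by
    rw [hφ]
    -- Relative dimensions add under composition, and the isomorphism has relative dimension 0.
    exact (inferInstance : SmoothOfRelativeDimension (0 + 1) (C.isoSpec.inv ≫ p))
  have hsm : Smooth (Spec.map φ) := SmoothOfRelativeDimension.smooth 1 _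
  rw [HasRingHomProperty.Spec_iff (P := @SmoothOfRelativeDimension 1)] at hdim
  rw [HasRingHomProperty.Spec_iff (P := @Smooth)] at hsm
  let : Algebra A Γ(C, ⊤) := φ.hom.toAlgebra
  have : Algebra.Smooth A Γ(C, ⊤) := hsm
  have hp : C.isoSpec.hom ≫ Spec.map (CommRingCat.ofHom (algebraMap A Γ(C, ⊤))) = p :=
    (Iso.eq_inv_comp _).mp hφ
  obtain ⟨I, y, hy⟩ := IsClosedImmersion.Spec_iff.mp
    (inferInstance : IsClosedImmersion (i ≫ C.isoSpec.hom))
  have hq : y.hom ≫ Spec.map (CommRingCat.ofHom (algebraMap A (Γ(C, ⊤) ⧸ I))) = i ≫ p := by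
    rw [IsScalarTower.algebraMap_eq A Γ(C, ⊤) (Γ(C, ⊤) ⧸ I), CommRingCat.ofHom_comp, Spec.map_comp,
      ← Category.assoc, Ideal.Quotient.algebraMap_eq]
    erw [← hy]
    rw [Category.assoc, hp]
  have hqf : Algebra.QuasiFinite A (Γ(C, ⊤) ⧸ I) := by
    have : LocallyQuasiFinite
        (Spec.map (CommRingCat.ofHom (algebraMap A (Γ(C, ⊤) ⧸ I)))) := by
      rw [← (Iso.inv_comp_eq y).mpr hq.symm]
      infer_instance
    rw [HasRingHomProperty.Spec_iff (P := @LocallyQuasiFinite)] at this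
    exact RingHom.quasiFinite_algebraMap.mp this
  refine Reembed.exists_open_of_hasEtaleCoordinate I
    (Reembed.hasEtaleCoordinate_of_quasiFinite ?_ I fun m ↦ ?_) p i C.isoSpec hp y hy
  · exact fun P ↦ Reembed.rankAtStalk_kaehlerDifferential_of_locally 1 hdim P
  · have := _hι_closed m
    exact Reembed.exists_generator_of_isClosedImmersion m _ y hq (ι m) (_hι_over m)
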